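/- Consider the linear time-invariant system $x_{k+1}=Ax_k+Bu_k$, $y_k=Cx_k+Du_k$ with $x_k\in\mathbb R^n$, $u_k\in\mathbb R^m$, $y_k\in\mathbb R^p$, where $(A,B)$ is controllable and $(A,C)$ is observable. Let $\{u^{\mathrm d}_k,y^{\mathrm d}_k\}_{k=0}^{N-1}$ be an input-output trajectory of this system, let $Q,R\succ0$, $\mathbb U\subseteq\mathbb R^m$, $\mathbb Y\subseteq\mathbb R^p$, and let $L$ be a horizon. For a sequence $w_0,\dots,w_{N-1}$ let $H_\ell(w)$ be the Hankel matrix with $\ell$ block rows and block entries $w_{i+j}$ ($0\le i\le \ell-1$, $0\le j\le N-\ell$). Write $\|v\|_P^2=v^\top Pv$, and let $\xi_t=(u_{t-n},\dots,u_{t-1},y_{t-n},\dots,y_{t-1})\in\mathbb R^{(m+p)n}$ be the extended state. For $\xi=\xi_t$, consider the problem $$\min_{\alpha,\bar u,\bar y}\ \sum_{k=0}^{L-1}\|\bar u_k\|_R^2+\|\bar y_k\|_Q^2$$ over $\alpha$ and $\bar u=(\bar u_{-n},\dots,\bar u_{L-1})$, $\bar y=(\bar y_{-n},\dots,\bar y_{L-1})$,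 subject to $$\begin{bmatrix}\bar u\\\bar y\end{bmatrix}=\begin{bmatrix}H_{L+n}(u^{\mathrm d})\\H_{L+n}(y^{\mathrm d})\end{bmatrix}\alpha,\qquad (\bar u_{-n},\dots,\bar u_{-1},\bar y_{-n},\dots,\bar y_{-1})=\xi,$$ $\bar u_k\in\mathbb U$ and $\bar y_k\in\mathbb Y$ for $0\le k\le L-1$, and $\bar u_k=0$, $\bar y_k=0$ for $L-n\le k\le L-1$. Let $J_L^*(\xi)$ be its optimal cost, with $J_L^*(\xi)=\infty$ if it is infeasible. Assume: $u^{\mathrm d}$ is persistently exciting of order $L+2n$, i.e. $\operatorname{rank}H_{L+2n}(u^{\mathrm d})=m(L+2n)$; there is $c_{\mathrm u}>0$ with $J_L^*(\xi)\le c_{\mathrm u}\|\xi\|_2^2$ for every $\xi$ for which the problem is feasible; $\mathbb U$ is a compact convex polytope with $0\in\operatorname{int}\mathbb U$ and $\mathbb Y=\mathbb R^p$; and $L\ge 2n$. Consider the closed loop of the system, started with an input-output trajectory over the times $-n,\dots,-1$, under the $n$-step MPC scheme with input disturbance: at each time $t=ni$, $i\ge0$, the problem is solved for $\xi_t$ and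 $u_{t+k}=\bar u_k^*(t)+d_{t+k}$ is applied for $0\le k\le n-1$, where $\bar u^*(t)$ is the optimal input. (i) There exists $\bar d>0$ such that, for every disturbance with $\sup_{t\ge0}\|d_t\|_2\le\bar d$, if the problem is feasible at time $t=0$, then it is feasible at every time $t=ni$, $i\ge0$. (ii) There exist $P\succ0$ and $c_{\mathrm{IOSS}}>0$ such that $W(\xi)=\|\xi\|_P^2$ is an input-output-to-state stability (IOSS) Lyapunov function, i.e. $$W(\xi_{t+1})-W(\xi_t)\le-\|\xi_t\|_2^2+c_{\mathrm{IOSS}}\big(\|u_t\|_R^2+\|y_t\|_Q^2\big)$$ along all trajectories of the system. For any such $P$ and $c_{\mathrm{IOSS}}$, let $V(\xi)=J_L^*(\xi)+\frac1{c_{\mathrm{IOSS}}}W(\xi)$. Then for every $\overline V>0$ there exist $\bar d_{\max},\bar c_{\mathrm l},\bar c_{\mathrm u}>0$, $0<c_{\mathrm V}<1$ and $\beta_{\mathrm d}\in\mathcal K_\infty$ (continuous, strictly increasing and unbounded on $[0,\infty)$ with $\beta_{\mathrm d}(0)=0$) such that, for all initial conditions with $V(\xi_0)\le\overline V$, all $0\le\bar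 d\le\bar d_{\max}$, all disturbances with $\sup_{t\ge0}\|d_t\|_2\le\bar d$, and all times $t=ni$, $i\ge0$, $$\bar c_{\mathrm l}\|\xi_t\|_2^2\le V(\xi_t)\le\bar c_{\mathrm u}\|\xi_t\|_2^2,\qquad V(\xi_{t+n})\le c_{\mathrm V}V(\xi_t)+\beta_{\mathrm d}(\bar d).$$ -/

import Mathlib

open scoped Matrix NNReal ENNReal

noncomputable section

namespace DDMPC

/-- The Euclidean norm `‖v‖₂` of a finite real vector. -/
def norm2 {ι : Type*} [Fintype ι] (v : ι → ℝ) : ℝ := ‖WithLp.toLp 2 v‖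

/-- The squared weighted norm `‖v‖_P² = vᵀ P v`. -/
def wsq {ι : Type*} [Fintype ι] (P : Matrix ι ι ℝ) (v : ι → ℝ) : ℝ := v ⬝ᵥ (P *ᵥ v)

/-- The class `𝒦_∞`: continuous, strictly increasing, unbounded functions on the nonnegative
reals that vanish at zero. -/
structure IsKInfty (β : ℝ≥0 → ℝ≥0) : Prop where
  continuous : Continuous β
  strictMono : StrictMono β
  unbounded : ∀ r : ℝ≥0, ∃ s : ℝ≥0, r ≤ β s
  map_zero : β 0 = 0

/-- The matrices of the system `x⁺ = A x + B u`, `y = C x + D u`. -/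
structure LTI (n m p : ℕ) where
  A : Matrix (Fin n) (Fin n) ℝ
  B : Matrix (Fin n) (Fin m) ℝ
  C : Matrix (Fin p) (Fin n) ℝ
  D : Matrix (Fin p) (Fin m) ℝ

namespace LTI

variable {n m p : ℕ}

/-- `(A, B)` is controllable: `[B, AB, …, A^{n-1}B]` has rank `n`. -/
def Controllable (S : LTI n m p) : Prop :=
  (Matrix.of fun (i : Fin n) (kj : Fin n × Fin m) => (S.A ^ (kj.1 : ℕ) * S.B) i kj.2).rank = n

/-- `(A, C)` is observable: the matrix with block rows `C, CA, …, CA^{n-1}` has rank `n`. -/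
def Observable (S : LTI n m p) : Prop :=
  (Matrix.of fun (kj : Fin n × Fin p) (i : Fin n) => (S.C * S.A ^ (kj.1 : ℕ)) kj.2 i).rank = n

/-- `u_0, …, u_{N-1}` and `y_0, …, y_{N-1}` form an input-output trajectory of the system
(entries with index at least `N` play no role). -/
def IsIOTrajectory (S : LTI n m p) (N : ℕ) (u : ℕ → Fin m → ℝ) (y : ℕ → Fin p → ℝ) : Prop :=
  ∃ x : ℕ → Fin n → ℝ, ∀ k < N,
    x (k + 1) = S.A *ᵥ x k + S.B *ᵥ u k ∧ y k = S.C *ᵥ x k + S.D *ᵥ u k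

/-- `(x, u, y)` obeys the system equations at all times `k ≥ -n`; the times `-n, …, -1` provide
the initial input-output data. -/
def IsRun (S : LTI n m p) (x : ℤ → Fin n → ℝ) (u : ℤ → Fin m → ℝ) (y : ℤ → Fin p → ℝ) : Prop :=
  ∀ k : ℤ, -(n : ℤ) ≤ k →
    x (k + 1) = S.A *ᵥ x k + S.B *ᵥ u k ∧ y k = S.C *ᵥ x k + S.D *ᵥ u k

end LTI

/-- The block Hankel matrix `H_L(w)` of `w_0, …, w_{N-1}`: it has `L` block rows and `N - L + 1`
columns (none if `N < L`), and its block in row `i` and column `j` is `w_{i+j}`. -/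
def hankel {q : ℕ} (N L : ℕ) (w : ℕ → Fin q → ℝ) :
    Matrix (Fin L × Fin q) (Fin (N + 1 - L)) ℝ :=
  Matrix.of fun i j => w ((i.1 : ℕ) + (j : ℕ)) i.2

/-- Persistence of excitation of order `L` of `w_0, …, w_{N-1}`. -/
def PersistentlyExciting {q : ℕ} (N L : ℕ) (w : ℕ → Fin q → ℝ) : Prop :=
  (hankel N L w).rank = q * L

/-- Index set of the extended state: `n` past inputs and `n` past outputs. -/
abbrev ExtIdx (n m p : ℕ) : Type := (Fin n × Fin m) ⊕ (Fin n × Fin p)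

/-- The extended state `ξ_t`, stacking `u_{t-n}, …, u_{t-1}` and `y_{t-n}, …, y_{t-1}`. -/
def extState {m p : ℕ} (n : ℕ) (u : ℤ → Fin m → ℝ) (y : ℤ → Fin p → ℝ) (t : ℤ) :
    ExtIdx n m p → ℝ :=
  Sum.elim (fun kj => u (t - n + ((kj.1 : ℕ) : ℤ)) kj.2)
    (fun kj => y (t - n + ((kj.1 : ℕ) : ℤ)) kj.2)

/-- The data of the optimal control problem: the recorded trajectory (of length `N`), the horizon
`L`, the weights and the constraint sets. -/
structure OCP (m p : ℕ) where
  N : ℕ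
  L : ℕ
  ud : ℕ → Fin m → ℝ
  yd : ℕ → Fin p → ℝ
  R : Matrix (Fin m) (Fin m) ℝ
  Q : Matrix (Fin p) (Fin p) ℝ
  U : Set (Fin m → ℝ)
  Y : Set (Fin p → ℝ)

namespace OCP

variable {m p : ℕ}

/-- The decision variables `α`, `ū`, `ȳ`. The predicted sequences have the time indices
`-n, …, L-1`, stored with an offset: `ū_{k-n}` is `ubar (Fin.castAdd L k)` for `k < n`, and
`ū_k` is `ubar (Fin.natAdd n k)` for `k < L`. -/
structure Var (O : OCP m p) (n : ℕ) where
  alpha : Fin (O.N + 1 - (n + O.L)) → ℝ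
  ubar : Fin (n + O.L) → Fin m → ℝ
  ybar : Fin (n + O.L) → Fin p → ℝ

/-- The constraints of the problem with initial condition `ξ`. -/
structure IsFeasiblePoint (O : OCP m p) {n : ℕ} (ξ : ExtIdx n m p → ℝ) (s : O.Var n) : Prop where
  hankel_u : ∀ k j, s.ubar k j = (hankel O.N (n + O.L) O.ud *ᵥ s.alpha) (k, j)
  hankel_y : ∀ k j, s.ybar k j = (hankel O.N (n + O.L) O.yd *ᵥ s.alpha) (k, j)
  init_u : ∀ (k : Fin n) (j : Fin m), s.ubar (Fin.castAdd O.L k) j = ξ (Sum.inl (k, j))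
  init_y : ∀ (k : Fin n) (j : Fin p), s.ybar (Fin.castAdd O.L k) j = ξ (Sum.inr (k, j))
  mem_U : ∀ k : Fin O.L, s.ubar (Fin.natAdd n k) ∈ O.U
  mem_Y : ∀ k : Fin O.L, s.ybar (Fin.natAdd n k) ∈ O.Y
  terminal : ∀ k : Fin O.L, O.L ≤ (k : ℕ) + n →
    s.ubar (Fin.natAdd n k) = 0 ∧ s.ybar (Fin.natAdd n k) = 0

/-- The cost `∑_{k=0}^{L-1} ‖ū_k‖_R² + ‖ȳ_k‖_Q²`. -/
def cost (O : OCP m p) {n : ℕ} (s : O.Var n) : ℝ :=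
  ∑ k : Fin O.L, (wsq O.R (s.ubar (Fin.natAdd n k)) + wsq O.Q (s.ybar (Fin.natAdd n k)))

/-- The problem with initial condition `ξ` is feasible. -/
def Feasible (O : OCP m p) {n : ℕ} (ξ : ExtIdx n m p → ℝ) : Prop :=
  ∃ s : O.Var n, O.IsFeasiblePoint ξ s

/-- `s` is an optimal solution of the problem with initial condition `ξ`. -/
def IsOptimal (O : OCP m p) {n : ℕ} (ξ : ExtIdx n m p → ℝ) (s : O.Var n) : Prop :=
  O.IsFeasiblePoint ξ s ∧ ∀ s' : O.Var n, O.IsFeasiblePoint ξ s' → O.cost s ≤ O.cost s'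

/-- The optimal cost `J_L^*(ξ)`, equal to `∞` when the problem is infeasible. -/
def optCost (O : OCP m p) {n : ℕ} (ξ : ExtIdx n m p → ℝ) : ℝ≥0∞ :=
  ⨅ (s : O.Var n) (_ : O.IsFeasiblePoint ξ s), ENNReal.ofReal (O.cost s)

/-- `W(ξ) = ‖ξ‖_P²` with `P ≻ 0` is an input-output-to-state stability Lyapunov function with
constant `c > 0`, along all trajectories of the system. -/
def IsIOSS (O : OCP m p) {n : ℕ} (S : LTI n m p)
    (P : Matrix (ExtIdx n m p) (ExtIdx n m p) ℝ) (c : ℝ) : Prop :=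
  P.PosDef ∧ 0 < c ∧
    ∀ (x : ℤ → Fin n → ℝ) (u : ℤ → Fin m → ℝ) (y : ℤ → Fin p → ℝ), S.IsRun x u y → ∀ t : ℕ,
      wsq P (extState n u y ((t : ℤ) + 1)) - wsq P (extState n u y t) ≤
        -norm2 (extState n u y t) ^ 2 + c * (wsq O.R (u t) + wsq O.Q (y t))

/-- `V(ξ) = J_L^*(ξ) + W(ξ) / c`. -/
def lyap (O : OCP m p) {n : ℕ} (P : Matrix (ExtIdx n m p) (ExtIdx n m p) ℝ) (c : ℝ)
    (ξ : ExtIdx n m p → ℝ) : ℝ≥0∞ :=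
  O.optCost ξ + ENNReal.ofReal (1 / c * wsq P ξ)

/-- `(x, u, y)` is a closed loop of the system under the `n`-step MPC scheme with input
disturbance `d`: at every time `t = n i`, an optimal solution for the current `ξ_t` is computed
(if there is any) and `u_{t+k} = ū_k^*(t) + d_{t+k}` is applied for `k = 0, …, n-1`. -/
def IsClosedLoop (O : OCP m p) {n : ℕ} (S : LTI n m p) (d : ℕ → Fin m → ℝ)
    (x : ℤ → Fin n → ℝ) (u : ℤ → Fin m → ℝ) (y : ℤ → Fin p → ℝ) : Prop :=
  S.IsRun x u y ∧
    ∀ i : ℕ, (∃ s : O.Var n, O.IsOptimal (extState n u y ((n * i : ℕ) : ℤ)) s) →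
      ∃ s : O.Var n, O.IsOptimal (extState n u y ((n * i : ℕ) : ℤ)) s ∧
        ∀ k : Fin O.L, (k : ℕ) < n →
          u ((n * i + k : ℕ) : ℤ) = s.ubar (Fin.natAdd n k) + d (n * i + k)

end OCP

end DDMPC

end

/-! By Willems' fundamental lemma (`exists_hankel_mulVec_eq`, converse `exists_state_of_hankel`),
the Hankel constraint describes exactly the system trajectories of length `L + n`. The data-driven
problem is therefore a model-based one, and its feasible points are exchanged with state-space
trajectories (`IsPlan`). Observability turns the `n` zero terminal inputs and outputs into a zero
terminal state.

Recursive feasibility: the disturbed trajectory differs from the plan by the response `e` to an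
input perturbation over `n` steps. Shift the plan by `n` and let that response evolve freely, then
steer it to zero by deadbeat control in the last `n` steps of the old horizon (`exists_correction`;
`2 * n ≤ L` keeps the two windows apart). There the old planned input is zero, so a small correction
stays in a ball around `0` inside `𝕌`, even if the plan touches the boundary of `𝕌` elsewhere.

Lyapunov decrease: let `N₁` be the cost of the first `n` planned stages and `E` a multiple of the
squared disturbance bound. Young's inequality bounds the candidate cost by `(1 + ε) * (J - N₁) + L *
E`. The IOSS inequality over `n` steps bounds the change of `W / c` by `-‖ξ‖² / c + (1 + ε) * N₁ + n
* E`. In the sum `N₁` cancels, and `J ≤ cu * ‖ξ‖²` lets a small `ε` absorb `ε * J` into half of the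
decrease. Since `V ≤ (cu + Lam / c) * ‖ξ‖²`, what remains is a contraction plus a term quadratic in
the disturbance bound. -/

namespace DDMPC

/-! ### Weighted and Euclidean norms. -/

section Norms

variable {ι κ : Type*} [Fintype ι] [Fintype κ]

theorem norm2_nonneg (v : ι → ℝ) : 0 ≤ norm2 v := norm_nonneg _

theorem norm2_sq (v : ι → ℝ) : norm2 v ^ 2 = ∑ i, v i ^ 2 :=
  EuclideanSpace.real_norm_sq_eq (WithLp.toLp 2 v)

theorem norm_le_norm2 (v : ι → ℝ) : ‖v‖ ≤ norm2 v :=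
  (pi_norm_le_iff_of_nonneg (norm2_nonneg v)).2 fun i =>
    PiLp.norm_apply_le (WithLp.toLp 2 v) i

theorem exists_norm_mulVec_le (M : Matrix ι κ ℝ) :
    ∃ c : ℝ, 0 ≤ c ∧ ∀ v, ‖M *ᵥ v‖ ≤ c * ‖v‖ :=
  ⟨‖LinearMap.toContinuousLinearMap M.mulVecLin‖, norm_nonneg _, fun v =>
    (LinearMap.toContinuousLinearMap M.mulVecLin).le_opNorm v⟩

theorem wsq_smul (M : Matrix ι ι ℝ) (a : ℝ) (v : ι → ℝ) : wsq M (a • v) = a ^ 2 * wsq M v := by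
  simp only [wsq, Matrix.mulVec_smul, smul_dotProduct, dotProduct_smul, smul_eq_mul]
  ring

@[simp] theorem wsq_zero (M : Matrix ι ι ℝ) : wsq M 0 = 0 := by
  simp [wsq]

theorem wsq_nonneg {M : Matrix ι ι ℝ} (hM : M.PosDef) (v : ι → ℝ) : 0 ≤ wsq M v := by
  simpa [wsq] using hM.posSemidef.dotProduct_mulVec_nonneg v

theorem continuous_wsq (M : Matrix ι ι ℝ) : Continuous (wsq M) := by
  unfold wsq
  fun_prop

/-- Young's inequality, obtained by expanding `0 ≤ wsq M (ε • a - b)`. It lets perturbed costs be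
compared with nominal ones at the price of a factor `1 + ε`. -/
theorem wsq_add_le {M : Matrix ι ι ℝ} (hM : M.PosDef) {ε : ℝ} (hε : 0 < ε) (a b : ι → ℝ) :
    wsq M (a + b) ≤ (1 + ε) * wsq M a + (1 + 1 / ε) * wsq M b := by
  have h := wsq_nonneg hM (ε • a - b)
  have e1 : wsq M (ε • a - b) =
      ε ^ 2 * wsq M a - ε * (a ⬝ᵥ (M *ᵥ b) + b ⬝ᵥ (M *ᵥ a)) + wsq M b := by
    simp only [wsq, Matrix.mulVec_smul, Matrix.mulVec_sub, dotProduct_sub, sub_dotProduct,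
      smul_dotProduct, dotProduct_smul, smul_eq_mul]
    ring
  have e2 : wsq M (a + b) = wsq M a + (a ⬝ᵥ (M *ᵥ b) + b ⬝ᵥ (M *ᵥ a)) + wsq M b := by
    simp only [wsq, Matrix.mulVec_add, dotProduct_add, add_dotProduct]
    ring
  have h3 : a ⬝ᵥ (M *ᵥ b) + b ⬝ᵥ (M *ᵥ a) ≤ ε * wsq M a + 1 / ε * wsq M b := by
    rw [e1] at h
    have : ε * (a ⬝ᵥ (M *ᵥ b) + b ⬝ᵥ (M *ᵥ a)) ≤ ε * (ε * wsq M a + 1 / ε * wsq M b) := by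
      field_simp
      linarith
    exact le_of_mul_le_mul_left this hε
  rw [e2]
  linarith

theorem exists_wsq_le_norm (M : Matrix ι ι ℝ) :
    ∃ c : ℝ, 0 ≤ c ∧ ∀ v, wsq M v ≤ c * ‖v‖ ^ 2 := by
  obtain ⟨c, hc, h⟩ := exists_norm_mulVec_le M
  refine ⟨Fintype.card ι * c, by positivity, fun v => ?_⟩
  calc wsq M v ≤ ∑ _i : ι, ‖v‖ * (c * ‖v‖) := by
        refine Finset.sum_le_sum fun i _ => (le_abs_self _).trans ?_
        rw [abs_mul]
        exact mul_le_mul (norm_le_pi_norm v i) ((norm_le_pi_norm (M *ᵥ v) i).trans (h v))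
          (abs_nonneg _) (norm_nonneg _)
    _ = Fintype.card ι * c * ‖v‖ ^ 2 := by
        simp
        ring

theorem exists_wsq_le_norm2 (M : Matrix ι ι ℝ) :
    ∃ c : ℝ, 0 ≤ c ∧ ∀ v, wsq M v ≤ c * norm2 v ^ 2 := by
  obtain ⟨c, hc, h⟩ := exists_wsq_le_norm M
  refine ⟨c, hc, fun v => (h v).trans ?_⟩
  have := norm_le_norm2 v
  gcongr

theorem exists_norm2_le_wsq {M : Matrix ι ι ℝ} (hM : M.PosDef) :
    ∃ c : ℝ, 0 < c ∧ ∀ v, c * norm2 v ^ 2 ≤ wsq M v := by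
  have hcont : Continuous fun w : EuclideanSpace ℝ ι => wsq M w.ofLp :=
    (continuous_wsq M).comp (PiLp.continuous_ofLp 2 _)
  by_cases hne : (Metric.sphere (0 : EuclideanSpace ℝ ι) 1).Nonempty
  · obtain ⟨w, hw, hmin⟩ :=
      (isCompact_sphere (0 : EuclideanSpace ℝ ι) 1).exists_isMinOn hne hcont.continuousOn
    have hw0 : w.ofLp ≠ 0 := by
      intro h
      have h0 : w = 0 := by
        ext i
        simp [h]
      simp [h0] at hw
    refine ⟨wsq M w.ofLp, by simpa [wsq] using hM.dotProduct_mulVec_pos hw0, fun v => ?_⟩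
    by_cases hv : norm2 v = 0
    · rw [hv]
      simpa using wsq_nonneg hM v
    · have hs : (norm2 v)⁻¹ • WithLp.toLp 2 v ∈ Metric.sphere (0 : EuclideanSpace ℝ ι) 1 := by
        rw [mem_sphere_zero_iff_norm, norm_smul, norm_inv, Real.norm_of_nonneg (norm2_nonneg v)]
        exact inv_mul_cancel₀ hv
      have h1 : wsq M w.ofLp ≤ wsq M ((norm2 v)⁻¹ • v) := hmin hs
      rw [wsq_smul] at h1
      have hpos : 0 < norm2 v ^ 2 := by positivity
      calc wsq M w.ofLp * norm2 v ^ 2 ≤ ((norm2 v)⁻¹ ^ 2 * wsq M v) * norm2 v ^ 2 := by gcongr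
        _ = wsq M v := by field_simp
  -- An empty sphere leaves only vectors of norm zero, so any constant works.
  · refine ⟨1, one_pos, fun v => ?_⟩
    have hv : norm2 v = 0 := by
      by_contra hv
      refine hne ⟨(norm2 v)⁻¹ • WithLp.toLp 2 v, ?_⟩
      rw [mem_sphere_zero_iff_norm, norm_smul, norm_inv, Real.norm_of_nonneg (norm2_nonneg v)]
      exact inv_mul_cancel₀ hv
    rw [hv]
    simpa using wsq_nonneg hM v

end Norms

/-! ### Full rank as injectivity, surjectivity and absence of left annihilators. -/

section Rank

theorem mulVec_injective_of_rank_eq_card {ι κ : Type*} [Fintype κ] {M : Matrix ι κ ℝ}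
    (h : M.rank = Fintype.card κ) :
    Function.Injective M.mulVec := by
  have h1 := LinearMap.finrank_range_add_finrank_ker M.mulVecLin
  rw [Module.finrank_fintype_fun_eq_card] at h1
  have h2 : Module.finrank ℝ (LinearMap.ker M.mulVecLin) = 0 := by
    have : Module.finrank ℝ (LinearMap.range M.mulVecLin) = Fintype.card κ := h
    omega
  exact LinearMap.ker_eq_bot.1 (Submodule.finrank_eq_zero.1 h2)

variable {ι κ : Type*} [Fintype ι] [Fintype κ]

theorem mulVec_surjective_of_rank_eq_card {M : Matrix ι κ ℝ} (h : M.rank = Fintype.card ι) :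
    Function.Surjective M.mulVec := by
  have : LinearMap.range M.mulVecLin = ⊤ := by
    apply Submodule.eq_top_of_finrank_eq
    rw [Module.finrank_fintype_fun_eq_card]
    exact h
  exact LinearMap.range_eq_top.1 this

theorem eq_zero_of_vecMul_eq_zero {M : Matrix ι κ ℝ} (h : Function.Surjective M.mulVec)
    {v : ι → ℝ} (hv : v ᵥ* M = 0) : v = 0 := by
  obtain ⟨z, hz⟩ := h v
  rw [← dotProduct_self_eq_zero]
  nth_rewrite 2 [← hz]
  rw [Matrix.dotProduct_mulVec, hv, zero_dotProduct]

theorem mulVec_surjective_of_vecMul {M : Matrix ι κ ℝ} (h : ∀ v, v ᵥ* M = 0 → v = 0) :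
    Function.Surjective M.mulVec := by
  classical
  rw [← Matrix.coe_mulVecLin, ← LinearMap.range_eq_top]
  by_contra hne
  obtain ⟨f, hf, hle⟩ := Submodule.exists_le_ker_of_lt_top _ (lt_top_iff_ne_top.2 hne)
  have hfv : ∀ w, f w = (fun i => f (Pi.single i 1)) ⬝ᵥ w := fun w => by
    conv_lhs => rw [pi_eq_sum_univ' w]
    simp [dotProduct, map_sum, mul_comm]
  apply hf
  have h0 := h (fun i => f (Pi.single i 1)) (by
    rw [← dotProduct_self_eq_zero, ← Matrix.dotProduct_mulVec, ← hfv]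
    exact hle ⟨_, rfl⟩)
  ext i
  simpa using congrFun h0 i

end Rank

/-! ### Consequences of controllability and observability. -/

namespace LTI

variable {n m p : ℕ} {S : LTI n m p}

theorem Controllable.mulVec_surjective (h : S.Controllable) :
    Function.Surjective (Matrix.of fun (i : Fin n) (kj : Fin n × Fin m) =>
      (S.A ^ (kj.1 : ℕ) * S.B) i kj.2).mulVec :=
  mulVec_surjective_of_rank_eq_card (h.trans (Fintype.card_fin n).symm)

theorem Controllable.eq_zero (h : S.Controllable) {ξ : Fin n → ℝ}
    (hξ : ∀ k < n, ξ ᵥ* (S.A ^ k * S.B) = 0) : ξ = 0 :=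
  eq_zero_of_vecMul_eq_zero h.mulVec_surjective <| by
    ext ⟨k, j⟩
    exact congrFun (hξ k k.2) j

/-- A state sequence with zero input whose output vanishes for `n` steps starts at zero. -/
theorem Observable.eq_zero (h : S.Observable) {e : ℕ → Fin n → ℝ}
    (hstep : ∀ k < n, e (k + 1) = S.A *ᵥ e k) (hout : ∀ k < n, S.C *ᵥ e k = 0) : e 0 = 0 := by
  have hpow : ∀ k ≤ n, e k = (S.A ^ k) *ᵥ e 0 := by
    intro k
    induction k with
    | zero => simp
    | succ k ih =>
      intro hk
      rw [hstep k hk, ih (by omega), Matrix.mulVec_mulVec, pow_succ']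
  refine mulVec_injective_of_rank_eq_card (h.trans (Fintype.card_fin n).symm) ?_
  rw [Matrix.mulVec_zero]
  ext ⟨k, j⟩
  have := hout k k.2
  rw [hpow k k.2.le, Matrix.mulVec_mulVec] at this
  exact congrFun this j

/-- Two state sequences with the same inputs and outputs over `n` steps start at the same state. -/
theorem Observable.state_eq (h : S.Observable) {x x' : ℕ → Fin n → ℝ} {u : ℕ → Fin m → ℝ}
    {y : ℕ → Fin p → ℝ}
    (hx : ∀ k < n, x (k + 1) = S.A *ᵥ x k + S.B *ᵥ u k ∧ y k = S.C *ᵥ x k + S.D *ᵥ u k)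
    (hx' : ∀ k < n, x' (k + 1) = S.A *ᵥ x' k + S.B *ᵥ u k ∧ y k = S.C *ᵥ x' k + S.D *ᵥ u k) :
    ∀ k ≤ n, x k = x' k := by
  have h0 : x 0 = x' 0 := by
    refine sub_eq_zero.1 (h.eq_zero (e := fun k => x k - x' k) (fun k hk => ?_) fun k hk => ?_)
    · simp only [(hx k hk).1, (hx' k hk).1, Matrix.mulVec_sub]
      abel
    · have := (hx k hk).2.symm.trans (hx' k hk).2
      simp only [Matrix.mulVec_sub]
      rw [add_right_cancel this, sub_self]
  intro k
  induction k with
  | zero => exact fun _ => h0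
  | succ k ih =>
    intro hk
    rw [(hx k hk).1, (hx' k hk).1, ih (by omega)]

end LTI

/-! ### Willems' fundamental lemma. -/

section FundamentalLemma

variable {n m p : ℕ} {S : LTI n m p} {N K : ℕ}

/-- The block matrix whose columns are an initial state `x_j` stacked on the `K` inputs
`u_j, …, u_{j+K-1}`. -/
def stateInputMatrix (N K : ℕ) (x : ℕ → Fin n → ℝ) (u : ℕ → Fin m → ℝ) :
    Matrix (Fin n ⊕ (Fin K × Fin m)) (Fin (N + 1 - K)) ℝ :=
  Matrix.of fun i j => Sum.elim (fun a => x j a) (fun kb => u (kb.1 + j) kb.2) i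

/-- Shifting a left annihilator along the dynamics gives relations containing `ξ A^l x_j`.
Cayley–Hamilton combines those for `l ≤ n` into one without the state, that is, a left annihilator
of the input Hankel matrix of order `K + n`, which vanishes by persistence of excitation. With no
annihilator left, the matrix is surjective. -/
theorem vecMul_stateInputMatrix_eq_zero (hctrl : S.Controllable)
    {x : ℕ → Fin n → ℝ} {u : ℕ → Fin m → ℝ}
    (hx : ∀ k < N, x (k + 1) = S.A *ᵥ x k + S.B *ᵥ u k)
    (hpe : PersistentlyExciting N (K + n) u) {v : Fin n ⊕ (Fin K × Fin m) → ℝ}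
    (hv : v ᵥ* stateInputMatrix N K x u = 0) : v = 0 := by
  set ξ : Fin n → ℝ := fun a => v (Sum.inl a) with hξ
  -- Input coefficients in reverse time order: the entries below `K` come from `v`, and each further
  -- step of the dynamics appends a block `ξ A^l B`.
  set φ : ℕ → Fin m → ℝ := fun s => if h : s < K then
    fun b => v (Sum.inr (⟨K - 1 - s, by omega⟩, b)) else ξ ᵥ* (S.A ^ (s - K) * S.B) with hφ
  have hφlt : ∀ s (h : s < K) b, φ s b = v (Sum.inr (⟨K - 1 - s, by omega⟩, b)) := by
    intro s h b
    simp [hφ, h]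
  have hφge : ∀ l, φ (K + l) = ξ ᵥ* (S.A ^ l * S.B) := by
    intro l
    simp [hφ]
  -- the relation, propagated by `l` steps of the dynamics
  have hrel : ∀ l j, j + l < N + 1 - K →
      (ξ ᵥ* S.A ^ l) ⬝ᵥ x j + ∑ i ∈ Finset.range (K + l), φ (K + l - 1 - i) ⬝ᵥ u (i + j) = 0 := by
    intro l
    induction l with
    | zero =>
      intro j hj
      have h0 := congrFun hv ⟨j, by simpa using hj⟩
      simp only [Matrix.vecMul, dotProduct, Fintype.sum_sum_type, stateInputMatrix,
        Matrix.of_apply, Sum.elim_inl, Sum.elim_inr, Fintype.sum_prod_type, Pi.zero_apply] at h0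
      rw [← h0, pow_zero, Matrix.vecMul_one, add_zero, Finset.sum_range]
      congr 1
      refine Finset.sum_congr rfl fun i _ => Finset.sum_congr rfl fun b _ => ?_
      rw [hφlt _ (by omega)]
      congr 4
      ext
      simp only
      omega
    | succ l ih =>
      intro j hj
      have h1 := ih (j + 1) (by omega)
      rw [hx j (by omega), dotProduct_add, Matrix.dotProduct_mulVec, Matrix.dotProduct_mulVec,
        Matrix.vecMul_vecMul, Matrix.vecMul_vecMul, ← pow_succ] at h1
      have h2 : ∑ i ∈ Finset.range (K + l + 1), φ (K + l - i) ⬝ᵥ u (i + j) =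
          ∑ i ∈ Finset.range (K + l), φ (K + l - 1 - i) ⬝ᵥ u (i + (j + 1)) +
            (ξ ᵥ* (S.A ^ l * S.B)) ⬝ᵥ u j := by
        rw [Finset.sum_range_succ', Nat.sub_zero, hφge, Nat.zero_add]
        congr 1
        refine Finset.sum_congr rfl fun i _ => ?_
        rw [show K + l - (i + 1) = K + l - 1 - i by omega, show i + 1 + j = i + (j + 1) by omega]
      rw [show K + (l + 1) - 1 = K + l by omega, show K + (l + 1) = K + l + 1 by omega, h2]
      linarith
  set a : ℕ → ℝ := fun l => S.A.charpoly.coeff l with ha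
  have hdeg : S.A.charpoly.natDegree = n := by
    rw [Matrix.charpoly_natDegree_eq_dim, Fintype.card_fin]
  have han : a n = 1 := by
    have := S.A.charpoly_monic
    rw [Polynomial.Monic, Polynomial.leadingCoeff, hdeg] at this
    exact this
  have hCH : ∑ l ∈ Finset.range (n + 1), a l • S.A ^ l = 0 := by
    have := Matrix.aeval_self_charpoly S.A
    rwa [Polynomial.aeval_eq_sum_range, hdeg] at this
  -- Coefficients of the combination weighted by the characteristic polynomial, in which the state
  -- terms cancel.
  set c : ℕ → Fin m → ℝ := fun i => ∑ l ∈ Finset.range (n + 1),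
    if i < K + l then a l • φ (K + l - 1 - i) else 0 with hc
  have hcu : ∀ j, j + n < N + 1 - K →
      ∑ i ∈ Finset.range (K + n), c i ⬝ᵥ u (i + j) = 0 := by
    intro j hj
    have h1 : ∀ l ∈ Finset.range (n + 1), ∑ i ∈ Finset.range (K + n),
        (if i < K + l then a l • φ (K + l - 1 - i) else 0) ⬝ᵥ u (i + j) =
          - ((ξ ᵥ* (a l • S.A ^ l)) ⬝ᵥ x j) := by
      intro l hl
      have hl' := Finset.mem_range.1 hl
      have h2 := hrel l j (by omega)
      rw [← Finset.sum_subset (s₁ := Finset.range (K + l))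
        (Finset.range_mono (by omega)) (fun i _ hi => by
          rw [if_neg (by simpa using hi), zero_dotProduct])]
      rw [Finset.sum_congr rfl (g := fun i => a l * (φ (K + l - 1 - i) ⬝ᵥ u (i + j)))
        (fun i hi => by rw [if_pos (by simpa using hi), smul_dotProduct, smul_eq_mul]),
        ← Finset.mul_sum, eq_neg_of_add_eq_zero_right h2, Matrix.vecMul_smul, smul_dotProduct,
        smul_eq_mul, mul_neg]
    calc ∑ i ∈ Finset.range (K + n), c i ⬝ᵥ u (i + j)
        = ∑ l ∈ Finset.range (n + 1), ∑ i ∈ Finset.range (K + n),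
            (if i < K + l then a l • φ (K + l - 1 - i) else 0) ⬝ᵥ u (i + j) := by
          rw [Finset.sum_comm]
          refine Finset.sum_congr rfl fun i _ => ?_
          rw [hc, sum_dotProduct]
      _ = - ((ξ ᵥ* (∑ l ∈ Finset.range (n + 1), a l • S.A ^ l)) ⬝ᵥ x j) := by
          rw [Finset.sum_congr rfl h1, Finset.sum_neg_distrib, ← sum_dotProduct]
          congr 2
          exact (map_sum (Matrix.vecMulBilin ℝ ℝ ξ) _ _).symm
      _ = 0 := by rw [hCH]; simp
  have hc0 : ∀ i < K + n, c i = 0 := by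
    have hsurj : Function.Surjective (hankel N (K + n) u).mulVec :=
      mulVec_surjective_of_rank_eq_card (by
        rw [show (hankel N (K + n) u).rank = m * (K + n) from hpe]
        simp [mul_comm])
    have h0 : (fun kb : Fin (K + n) × Fin m => c kb.1 kb.2) = 0 := by
      refine eq_zero_of_vecMul_eq_zero hsurj ?_
      ext j
      have := hcu j (by omega)
      rw [Finset.sum_range] at this
      simpa only [Matrix.vecMul, dotProduct, hankel, Matrix.of_apply, Fintype.sum_prod_type,
        Pi.zero_apply] using this
    intro i hi
    ext b
    exact congrFun h0 (⟨i, hi⟩, b)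
  -- `c (K + n - 1 - s)` is `φ s` plus multiples of `φ` at smaller indices, because the
  -- characteristic polynomial is monic; the system is triangular.
  have hφ0 : ∀ s, s < K + n → φ s = 0 := by
    intro s
    induction s using Nat.strong_induction_on with
    | _ s ih =>
      intro hs
      have h1 := hc0 (K + n - 1 - s) (by omega)
      rw [hc] at h1
      simp only at h1
      rw [Finset.sum_range_succ, if_pos (by omega), han, one_smul, Finset.sum_eq_zero,
        zero_add, show K + n - 1 - (K + n - 1 - s) = s by omega] at h1
      · exact h1
      · intro l hl
        have hl' := Finset.mem_range.1 hl
        split_ifs with h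
        · rw [ih _ (by omega) (by omega), smul_zero]
        · rfl
  have hξ0 : ξ = 0 := hctrl.eq_zero fun k hk => by rw [← hφge, hφ0 _ (by omega)]
  ext i
  rcases i with i | ⟨k, b⟩
  · exact congrFun hξ0 i
  · have h1 := hφlt (K - 1 - k) (by omega) b
    rw [hφ0 _ (by omega)] at h1
    rw [Pi.zero_apply] at h1 ⊢
    rw [h1]
    congr 3
    ext
    simp only
    omega

/-- Willems' fundamental lemma: with persistently exciting data of a controllable system, every
trajectory of length `K` is a combination of the data windows of that length. -/
theorem exists_hankel_mulVec_eq (hctrl : S.Controllable) {ud : ℕ → Fin m → ℝ}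
    {yd : ℕ → Fin p → ℝ} (hdata : S.IsIOTrajectory N ud yd)
    (hpe : PersistentlyExciting N (K + n) ud)
    {x : ℕ → Fin n → ℝ} {u : ℕ → Fin m → ℝ} {y : ℕ → Fin p → ℝ}
    (hx : ∀ k < K, x (k + 1) = S.A *ᵥ x k + S.B *ᵥ u k ∧ y k = S.C *ᵥ x k + S.D *ᵥ u k) :
    ∃ α : Fin (N + 1 - K) → ℝ, ∀ k : Fin K,
      (∀ j, u k j = (hankel N K ud *ᵥ α) (k, j)) ∧ ∀ j, y k j = (hankel N K yd *ᵥ α) (k, j) := by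
  obtain ⟨xd, hxd⟩ := hdata
  obtain ⟨α, hα⟩ := mulVec_surjective_of_vecMul
    (fun v => vecMul_stateInputMatrix_eq_zero hctrl (fun k hk => (hxd k hk).1) hpe)
    (Sum.elim (x 0) (fun kb => u kb.1 kb.2))
  have hu : ∀ k < K, u k = ∑ j : Fin (N + 1 - K), α j • ud (k + j) := by
    intro k hk
    ext b
    have := congrFun hα (Sum.inr (⟨k, hk⟩, b))
    simpa [Matrix.mulVec, dotProduct, stateInputMatrix, mul_comm] using this.symm
  -- Initial state and inputs determine the trajectory, so coefficients matching these also match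
  -- all later states by linearity.
  have hx0 : ∀ k ≤ K, x k = ∑ j : Fin (N + 1 - K), α j • xd (k + j) := by
    intro k
    induction k with
    | zero =>
      intro _
      ext b
      have := congrFun hα (Sum.inl b)
      simpa [Matrix.mulVec, dotProduct, stateInputMatrix, mul_comm] using this.symm
    | succ k ih =>
      intro hk
      rw [(hx k hk).1, ih (by omega), hu k hk, Matrix.mulVec_sum, Matrix.mulVec_sum,
        ← Finset.sum_add_distrib]
      refine Finset.sum_congr rfl fun j _ => ?_
      rw [show k + 1 + (j : ℕ) = k + j + 1 by omega, (hxd (k + j) (by omega)).1, smul_add,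
        Matrix.mulVec_smul, Matrix.mulVec_smul]
  have hy : ∀ k < K, y k = ∑ j : Fin (N + 1 - K), α j • yd (k + j) := by
    intro k hk
    rw [(hx k hk).2, hx0 k hk.le, hu k hk, Matrix.mulVec_sum, Matrix.mulVec_sum,
        ← Finset.sum_add_distrib]
    refine Finset.sum_congr rfl fun j _ => ?_
    rw [(hxd (k + j) (by omega)).2, smul_add, Matrix.mulVec_smul, Matrix.mulVec_smul]
  refine ⟨α, fun k => ⟨fun j => ?_, fun j => ?_⟩⟩
  · rw [hu k k.2]
    simp [Matrix.mulVec, dotProduct, hankel, mul_comm]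
  · rw [hy k k.2]
    simp [Matrix.mulVec, dotProduct, hankel, mul_comm]

/-- Combinations of data windows are trajectories of the system. -/
theorem exists_state_of_hankel {ud : ℕ → Fin m → ℝ} {yd : ℕ → Fin p → ℝ}
    (hdata : S.IsIOTrajectory N ud yd) {u : ℕ → Fin m → ℝ} {y : ℕ → Fin p → ℝ}
    {α : Fin (N + 1 - K) → ℝ}
    (hu : ∀ (k : Fin K) j, u k j = (hankel N K ud *ᵥ α) (k, j))
    (hy : ∀ (k : Fin K) j, y k j = (hankel N K yd *ᵥ α) (k, j)) :
    ∃ x : ℕ → Fin n → ℝ, ∀ k < K,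
      x (k + 1) = S.A *ᵥ x k + S.B *ᵥ u k ∧ y k = S.C *ᵥ x k + S.D *ᵥ u k := by
  obtain ⟨xd, hxd⟩ := hdata
  have hu' : ∀ k < K, u k = ∑ j : Fin (N + 1 - K), α j • ud (k + j) := by
    intro k hk
    ext b
    rw [hu ⟨k, hk⟩ b]
    simp [Matrix.mulVec, dotProduct, hankel, mul_comm]
  have hy' : ∀ k < K, y k = ∑ j : Fin (N + 1 - K), α j • yd (k + j) := by
    intro k hk
    ext b
    rw [hy ⟨k, hk⟩ b]
    simp [Matrix.mulVec, dotProduct, hankel, mul_comm]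
  refine ⟨fun k => ∑ j : Fin (N + 1 - K), α j • xd (k + j), fun k hk => ⟨?_, ?_⟩⟩
  · rw [hu' k hk, Matrix.mulVec_sum, Matrix.mulVec_sum, ← Finset.sum_add_distrib]
    refine Finset.sum_congr rfl fun j _ => ?_
    rw [show k + 1 + (j : ℕ) = k + j + 1 by omega, (hxd (k + j) (by omega)).1, smul_add,
      Matrix.mulVec_smul, Matrix.mulVec_smul]
  · rw [hu' k hk, hy' k hk, Matrix.mulVec_sum, Matrix.mulVec_sum, ← Finset.sum_add_distrib]
    refine Finset.sum_congr rfl fun j _ => ?_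
    rw [(hxd (k + j) (by omega)).2, smul_add, Matrix.mulVec_smul, Matrix.mulVec_smul]

end FundamentalLemma

/-! ### Deadbeat control and compensation of input perturbations. -/

namespace LTI

variable {n m p : ℕ} {S : LTI n m p}

/-- The state sequence of the system from `x₀` under the input sequence `w`. -/
def traj (S : LTI n m p) (x₀ : Fin n → ℝ) (w : ℕ → Fin m → ℝ) : ℕ → Fin n → ℝ
  | 0 => x₀
  | k + 1 => S.A *ᵥ traj S x₀ w k + S.B *ᵥ w k

theorem traj_congr {x₀ : Fin n → ℝ} {w w' : ℕ → Fin m → ℝ} {T : ℕ} (h : ∀ k < T, w k = w' k) :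
    S.traj x₀ w T = S.traj x₀ w' T := by
  induction T with
  | zero => rfl
  | succ T ih =>
    rw [traj, traj, ih fun k hk => h k (by omega), h T (by omega)]

theorem traj_add (x₀ : Fin n → ℝ) (w : ℕ → Fin m → ℝ) (T k : ℕ) :
    S.traj x₀ w (T + k) = S.traj (S.traj x₀ w T) (fun j => w (T + j)) k := by
  induction k with
  | zero => rfl
  | succ k ih => rw [← Nat.add_assoc, traj, ih, traj]

theorem traj_zero {w : ℕ → Fin m → ℝ} (hw : ∀ k, w k = 0) (T : ℕ) : S.traj 0 w T = 0 := by
  induction T with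
  | zero => rfl
  | succ T ih => rw [traj, ih, hw]; simp

theorem traj_eq_sum (x₀ : Fin n → ℝ) (w : ℕ → Fin m → ℝ) (T : ℕ) :
    S.traj x₀ w T = (S.A ^ T) *ᵥ x₀ +
      ∑ k ∈ Finset.range T, (S.A ^ k * S.B) *ᵥ w (T - 1 - k) := by
  induction T with
  | zero => simp [traj]
  | succ T ih =>
    rw [traj, ih, Finset.sum_range_succ', Matrix.mulVec_add, Matrix.mulVec_mulVec, ← pow_succ',
      Matrix.mulVec_sum, add_assoc]
    congr 2
    · refine Finset.sum_congr rfl fun k _ => ?_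
      rw [Matrix.mulVec_mulVec, ← Matrix.mul_assoc, ← pow_succ',
        show T + 1 - 1 - (k + 1) = T - 1 - k by omega]
    · simp

theorem exists_norm_traj_le (S : LTI n m p) (T : ℕ) :
    ∃ c : ℝ, 0 ≤ c ∧ ∀ (w : ℕ → Fin m → ℝ) (M : ℝ), (∀ k, ‖w k‖ ≤ M) →
      ∀ k ≤ T, ‖S.traj 0 w k‖ ≤ c * M := by
  obtain ⟨a, ha, hA⟩ := exists_norm_mulVec_le S.A
  obtain ⟨b, hb, hB⟩ := exists_norm_mulVec_le S.B
  induction T with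
  | zero =>
    refine ⟨0, le_rfl, fun w M _ k hk => ?_⟩
    obtain rfl : k = 0 := by omega
    simp [traj]
  | succ T ih =>
    obtain ⟨c, hc, h⟩ := ih
    refine ⟨c + (a * c + b), by positivity, fun w M hw k hk => ?_⟩
    have hM : 0 ≤ M := (norm_nonneg _).trans (hw 0)
    have hT := h w M hw T le_rfl
    rcases Nat.lt_or_ge T k with hk' | hk'
    · obtain rfl : k = T + 1 := by omega
      calc ‖S.traj 0 w (T + 1)‖ ≤ ‖S.A *ᵥ S.traj 0 w T‖ + ‖S.B *ᵥ w T‖ := norm_add_le _ _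
        _ ≤ a * (c * M) + b * M := by
          refine add_le_add ((hA _).trans ?_) ((hB _).trans ?_)
          · gcongr
          · have := hw T
            gcongr
        _ ≤ (c + (a * c + b)) * M := by nlinarith [mul_nonneg hc hM]
    · refine (h w M hw k hk').trans ?_
      gcongr
      nlinarith [mul_nonneg ha hc]

/-- Deadbeat control: any state can be steered to the origin in `n` steps by an input that is
bounded linearly by the state. -/
theorem Controllable.exists_deadbeat (h : S.Controllable) :
    ∃ c : ℝ, 0 ≤ c ∧ ∀ δ : Fin n → ℝ, ∃ v : ℕ → Fin m → ℝ,
      (∀ k, ‖v k‖ ≤ c * ‖δ‖) ∧ S.traj δ v n = 0 := by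
  set Γ : Matrix (Fin n) (Fin n × Fin m) ℝ :=
    Matrix.of fun (i : Fin n) (kj : Fin n × Fin m) => (S.A ^ (kj.1 : ℕ) * S.B) i kj.2 with hΓ
  obtain ⟨G, hG⟩ := Γ.mulVecLin.exists_rightInverse_of_surjective
    (LinearMap.range_eq_top.2 h.mulVec_surjective)
  set F : (Fin n → ℝ) →L[ℝ] (Fin n × Fin m → ℝ) :=
    LinearMap.toContinuousLinearMap (G ∘ₗ (S.A ^ n).mulVecLin)
  have hF : ∀ δ, Γ *ᵥ F δ = (S.A ^ n) *ᵥ δ := fun δ =>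
    LinearMap.congr_fun hG ((S.A ^ n) *ᵥ δ)
  -- The blocks of `F δ` are reversed because `A^k B` multiplies the input at time `n - 1 - k`.
  refine ⟨‖F‖, norm_nonneg _, fun δ =>
    ⟨fun k => if hk : k < n then fun j => - F δ (⟨n - 1 - k, by omega⟩, j) else 0, ?_, ?_⟩⟩
  · intro k
    simp only
    split_ifs with hk
    · refine le_trans ?_ (F.le_opNorm δ)
      refine (pi_norm_le_iff_of_nonneg (norm_nonneg _)).2 fun j => ?_
      rw [norm_neg]
      exact norm_le_pi_norm (F δ) _
    · simpa using mul_nonneg (norm_nonneg F) (norm_nonneg δ)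
  · rw [traj_eq_sum, ← hF, Finset.sum_range, add_eq_zero_iff_eq_neg, ← Finset.sum_neg_distrib]
    ext i
    rw [Finset.sum_apply]
    simp only [Matrix.mulVec, dotProduct, hΓ, Matrix.of_apply, Fintype.sum_prod_type,
      Pi.neg_apply]
    refine Finset.sum_congr rfl fun k _ => ?_
    rw [← Finset.sum_neg_distrib]
    refine Finset.sum_congr rfl fun j _ => ?_
    have hk : (⟨n - 1 - (n - 1 - k), by omega⟩ : Fin n) = k :=
      Fin.ext (by simp only; omega)
    rw [dif_pos (by omega), mul_neg, neg_neg, hk]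

/-- An input perturbation over the first `n` steps can be compensated by small inputs in the
time window `L - n, …, L - 1`. -/
theorem Controllable.exists_correction (h : S.Controllable) {L : ℕ} (hL : 2 * n ≤ L) :
    ∃ K : ℝ, 0 < K ∧ ∀ (d : ℕ → Fin m → ℝ) (M : ℝ), (∀ k, ‖d k‖ ≤ M) →
      ∃ (e : ℕ → Fin n → ℝ) (w : ℕ → Fin m → ℝ), e 0 = 0 ∧
        (∀ k, e (k + 1) = S.A *ᵥ e k + S.B *ᵥ w k) ∧
        (∀ k < n, w k = d k) ∧ (∀ k, n ≤ k → k < L - n → w k = 0) ∧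
        (∀ k, L ≤ k → e k = 0 ∧ w k = 0) ∧
        ∀ k, ‖w k‖ ≤ K * M ∧ ‖S.C *ᵥ e k + S.D *ᵥ w k‖ ≤ K * M := by
  obtain ⟨c₁, hc₁, h₁⟩ := S.exists_norm_traj_le (L - n)
  obtain ⟨c₂, hc₂, h₂⟩ := S.exists_norm_traj_le L
  obtain ⟨g, hg, hdead⟩ := h.exists_deadbeat
  obtain ⟨a, ha, hC⟩ := exists_norm_mulVec_le S.C
  obtain ⟨b, hb, hD⟩ := exists_norm_mulVec_le S.D
  set κ : ℝ := 1 + g * c₁ with hκ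
  have hκ1 : 0 ≤ g * c₁ := by positivity
  have hκ0 : 0 < κ := by positivity
  refine ⟨κ + (a * (c₂ * κ) + b * κ), by positivity, fun d M hd => ?_⟩
  have hM : 0 ≤ M := (norm_nonneg _).trans (hd 0)
  set w₁ : ℕ → Fin m → ℝ := fun k => if k < n then d k else 0 with hw₁
  have hw₁M : ∀ k, ‖w₁ k‖ ≤ M := by
    intro k
    simp only [hw₁]
    split_ifs
    · exact hd k
    · simpa using hM
  set δ := S.traj 0 w₁ (L - n) with hδ
  obtain ⟨v, hv, hv0⟩ := hdead δ
  have hvM : ∀ k, ‖v k‖ ≤ g * (c₁ * M) := fun k =>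
    (hv k).trans (mul_le_mul_of_nonneg_left (h₁ w₁ M hw₁M _ le_rfl) hg)
  -- Perturbation, then zero input, then deadbeat control of the resulting state `δ` in the last `n`
  -- steps.
  set w : ℕ → Fin m → ℝ := fun k =>
    if k < L - n then w₁ k else if k < L then v (k - (L - n)) else 0 with hw
  have hwM : ∀ k, ‖w k‖ ≤ κ * M := by
    intro k
    have hgM : 0 ≤ g * (c₁ * M) := by positivity
    have e1 : κ * M = M + g * (c₁ * M) := by rw [hκ]; ring
    rw [e1]
    simp only [hw]
    split_ifs
    · linarith [hw₁M k]
    · linarith [hvM (k - (L - n))]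
    · rw [norm_zero]
      linarith
  have hwL : ∀ k, L ≤ k → w k = 0 := by
    intro k hk
    simp only [hw]
    rw [if_neg (by omega), if_neg (by omega)]
  have htL : S.traj 0 w L = 0 := by
    have e1 : L = L - n + n := by omega
    have e2 : S.traj 0 w (L - n) = δ := traj_congr fun k hk => by
      simp only [hw]
      rw [if_pos hk]
    rw [e1, traj_add, e2, traj_congr (w' := v), hv0]
    intro k hk
    simp only [hw]
    rw [if_neg (by omega), if_pos (by omega), Nat.add_sub_cancel_left]
  have ht0 : ∀ k, L ≤ k → S.traj 0 w k = 0 := by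
    intro k hk
    obtain ⟨j, rfl⟩ := Nat.exists_eq_add_of_le hk
    rw [traj_add, htL, traj_zero]
    intro i
    exact hwL _ (by omega)
  have htM : ∀ k, ‖S.traj 0 w k‖ ≤ c₂ * (κ * M) := by
    intro k
    rcases Nat.le_total k L with hk | hk
    · exact h₂ w _ hwM k hk
    · rw [ht0 k hk, norm_zero]
      positivity
  refine ⟨S.traj 0 w, w, rfl, fun k => rfl, fun k hk => ?_, fun k hk hk' => ?_,
    fun k hk => ⟨ht0 k hk, hwL k hk⟩, fun k => ⟨?_, ?_⟩⟩
  · simp only [hw, hw₁]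
    rw [if_pos (by omega), if_pos hk]
  · simp only [hw, hw₁]
    rw [if_pos (by omega), if_neg (by omega)]
  · refine (hwM k).trans (mul_le_mul_of_nonneg_right ?_ hM)
    have : 0 ≤ a * (c₂ * κ) + b * κ := by positivity
    linarith
  · calc ‖S.C *ᵥ S.traj 0 w k + S.D *ᵥ w k‖ ≤ ‖S.C *ᵥ S.traj 0 w k‖ + ‖S.D *ᵥ w k‖ :=
          norm_add_le _ _
      _ ≤ a * (c₂ * (κ * M)) + b * (κ * M) :=
          add_le_add ((hC _).trans (mul_le_mul_of_nonneg_left (htM k) ha))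
            ((hD _).trans (mul_le_mul_of_nonneg_left (hwM k) hb))
      _ ≤ (κ + (a * (c₂ * κ) + b * κ)) * M := by
          have : 0 ≤ κ * M := by positivity
          linarith

end LTI

/-! ### Feasible points as state-space plans, and existence of optimal solutions. -/

namespace OCP

variable {n m p : ℕ} {O : OCP m p} {S : LTI n m p} {ξ : ExtIdx n m p → ℝ}

/-- The stage cost of an input-output pair. -/
def stage (O : OCP m p) (a : Fin m → ℝ) (b : Fin p → ℝ) : ℝ := wsq O.R a + wsq O.Q b

theorem stage_nonneg (hR : O.R.PosDef) (hQ : O.Q.PosDef) (a : Fin m → ℝ) (b : Fin p → ℝ) :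
    0 ≤ O.stage a b :=
  add_nonneg (wsq_nonneg hR a) (wsq_nonneg hQ b)

@[simp] theorem stage_zero : O.stage 0 0 = 0 := by
  simp [stage]

/-- `(x, u, y)` is a predicted trajectory for the initial condition `ξ`, indexed from the start of
the initial window and continued by zero after the horizon. -/
structure IsPlan (O : OCP m p) (S : LTI n m p) (ξ : ExtIdx n m p → ℝ) (x : ℕ → Fin n → ℝ)
    (u : ℕ → Fin m → ℝ) (y : ℕ → Fin p → ℝ) : Prop where
  step : ∀ k, x (k + 1) = S.A *ᵥ x k + S.B *ᵥ u k ∧ y k = S.C *ᵥ x k + S.D *ᵥ u k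
  init_u : ∀ (k : Fin n) (j : Fin m), u k j = ξ (Sum.inl (k, j))
  init_y : ∀ (k : Fin n) (j : Fin p), y k j = ξ (Sum.inr (k, j))
  zero : ∀ k, O.L ≤ k → x k = 0 ∧ u k = 0 ∧ y k = 0
  mem_U : ∀ k, n ≤ k → u k ∈ O.U

/-- The excitation order `L + 2 * n` is the window length `n + L` plus the state dimension `n`, as
the fundamental lemma requires. -/
theorem IsPlan.exists_isFeasiblePoint (hctrl : S.Controllable)
    (hdata : S.IsIOTrajectory O.N O.ud O.yd)
    (hpe : PersistentlyExciting O.N (O.L + 2 * n) O.ud) (hY : O.Y = Set.univ)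
    {x : ℕ → Fin n → ℝ} {u : ℕ → Fin m → ℝ} {y : ℕ → Fin p → ℝ} (h : O.IsPlan S ξ x u y) :
    ∃ s : O.Var n, O.IsFeasiblePoint ξ s ∧
      O.cost s = ∑ k ∈ Finset.range O.L, O.stage (u (n + k)) (y (n + k)) := by
  rw [show O.L + 2 * n = n + O.L + n by omega] at hpe
  obtain ⟨α, hα⟩ := exists_hankel_mulVec_eq hctrl hdata hpe (K := n + O.L) fun k _ => h.step k
  refine ⟨⟨α, fun k => u k, fun k => y k⟩, ⟨fun k => (hα k).1, fun k => (hα k).2,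
    h.init_u, h.init_y, fun k => h.mem_U _ ?_, fun k => hY ▸ Set.mem_univ _, fun k hk => ?_⟩, ?_⟩
  · simp
  · have : O.L ≤ ((Fin.natAdd n k : Fin (n + O.L)) : ℕ) := by
      rw [Fin.val_natAdd]
      omega
    exact (h.zero _ this).2
  · rw [Finset.sum_range]
    rfl

theorem IsFeasiblePoint.exists_isPlan (hobs : S.Observable)
    (hdata : S.IsIOTrajectory O.N O.ud O.yd) (hU0 : (0 : Fin m → ℝ) ∈ O.U) (hL : n ≤ O.L)
    {s : O.Var n} (h : O.IsFeasiblePoint ξ s) :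
    ∃ (x : ℕ → Fin n → ℝ) (u : ℕ → Fin m → ℝ) (y : ℕ → Fin p → ℝ), O.IsPlan S ξ x u y ∧
      O.cost s = ∑ k ∈ Finset.range O.L, O.stage (u (n + k)) (y (n + k)) ∧
      ∀ k : Fin O.L, u (n + k) = s.ubar (Fin.natAdd n k) := by
  set u : ℕ → Fin m → ℝ := fun k => if hk : k < n + O.L then s.ubar ⟨k, hk⟩ else 0 with hu
  set y : ℕ → Fin p → ℝ := fun k => if hk : k < n + O.L then s.ybar ⟨k, hk⟩ else 0 with hy
  have hu' : ∀ k : Fin (n + O.L), u k = s.ubar k := fun k => by simp [hu]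
  have hy' : ∀ k : Fin (n + O.L), y k = s.ybar k := fun k => by simp [hy]
  have hzero : ∀ k, O.L ≤ k → u k = 0 ∧ y k = 0 := by
    intro k hk
    by_cases hk' : k < n + O.L
    · have := h.terminal ⟨k - n, by omega⟩ (by simp only; omega)
      rw [← hu', ← hy', Fin.val_natAdd] at this
      simpa only [show n + (k - n) = k by omega] using this
    · simp [hu, hy, hk']
  obtain ⟨x, hx⟩ := exists_state_of_hankel hdata (K := n + O.L) (u := u) (y := y) (α := s.alpha)
    (fun k j => by rw [hu', h.hankel_u]) (fun k j => by rw [hy', h.hankel_y])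
  -- Plan index `L` is time `L - n`, where the `n` zero inputs and outputs begin; observability
  -- gives a zero state.
  have hxL : x O.L = 0 := by
    refine hobs.eq_zero (e := fun k => x (O.L + k)) (fun k hk => ?_) fun k hk => ?_
    · have := (hx (O.L + k) (by omega)).1
      rwa [(hzero (O.L + k) (by omega)).1, Matrix.mulVec_zero, add_zero] at this
    · have := (hx (O.L + k) (by omega)).2
      rw [(hzero (O.L + k) (by omega)).1, (hzero (O.L + k) (by omega)).2, Matrix.mulVec_zero,
        add_zero] at this
      exact this.symm
  have hnat : ∀ k : Fin O.L, u (n + k) = s.ubar (Fin.natAdd n k) := fun k => by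
    rw [← hu', Fin.val_natAdd]
  have hnat' : ∀ k : Fin O.L, y (n + k) = s.ybar (Fin.natAdd n k) := fun k => by
    rw [← hy', Fin.val_natAdd]
  -- The data determine states only up to the end of the window; the zero continuation is consistent
  -- because `x O.L = 0`.
  refine ⟨fun k => if k < O.L then x k else 0, u, y, ⟨fun k => ?_, fun k j => ?_, fun k j => ?_,
    fun k hk => ⟨if_neg (by omega), hzero k hk⟩, fun k hk => ?_⟩, ?_, hnat⟩
  · by_cases hk : k < O.L
    · have h1 := hx k (by omega)
      refine ⟨?_, by simpa [hk] using h1.2⟩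
      by_cases hk' : k + 1 < O.L
      · simpa [hk, hk'] using h1.1
      · have e1 : k + 1 = O.L := by omega
        rw [e1, hxL] at h1
        simpa [hk, hk'] using h1.1
    · have hk' : ¬ k + 1 < O.L := by omega
      have := hzero k (by omega)
      simp [hk, hk', this]
  · exact (congrFun (hu' (Fin.castAdd O.L k)) j).trans (h.init_u k j)
  · exact (congrFun (hy' (Fin.castAdd O.L k)) j).trans (h.init_y k j)
  · by_cases hk' : k < O.L
    · have := h.mem_U ⟨k - n, by omega⟩
      rw [← hnat] at this
      simpa only [show n + (k - n) = k by omega] using this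
    · rw [(hzero k (by omega)).1]
      exact hU0
  · rw [Finset.sum_range, cost]
    refine Finset.sum_congr rfl fun k _ => ?_
    rw [stage, hnat, hnat']

/-- A feasible problem has an optimal solution. -/
theorem Feasible.exists_isOptimal (hR : O.R.PosDef) (hQ : O.Q.PosDef) (hU : IsClosed O.U)
    (hY : IsClosed O.Y) (h : O.Feasible ξ) : ∃ s : O.Var n, O.IsOptimal ξ s := by
  obtain ⟨s₀, hs₀⟩ := h
  obtain ⟨r, hr, hrR⟩ := exists_norm2_le_wsq hR
  obtain ⟨q, hq, hqQ⟩ := exists_norm2_le_wsq hQ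
  -- `α` may be unbounded on sublevel sets, so the minimisation runs over the pairs `(ū, ȳ)` in the
  -- closed range of `Φ`. There the initial window is fixed and the cost bounds the rest.
  let Φ : (Fin (O.N + 1 - (n + O.L)) → ℝ) →ₗ[ℝ]
      (Fin (n + O.L) → Fin m → ℝ) × (Fin (n + O.L) → Fin p → ℝ) :=
    { toFun := fun α => (fun k j => (hankel O.N (n + O.L) O.ud *ᵥ α) (k, j),
        fun k j => (hankel O.N (n + O.L) O.yd *ᵥ α) (k, j))
      map_add' := fun a b => by
        simp only [Matrix.mulVec_add]
        rfl
      map_smul' := fun a b => by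
        simp only [Matrix.mulVec_smul]
        rfl }
  let J : (Fin (n + O.L) → Fin m → ℝ) × (Fin (n + O.L) → Fin p → ℝ) → ℝ := fun e =>
    ∑ k : Fin O.L, (wsq O.R (e.1 (Fin.natAdd n k)) + wsq O.Q (e.2 (Fin.natAdd n k)))
  have hJ : Continuous J := by
    have h1 := continuous_wsq O.R
    have h2 := continuous_wsq O.Q
    refine continuous_finsetSum _ fun k _ => (h1.comp ?_).add (h2.comp ?_) <;> fun_prop
  let Z : Set ((Fin (n + O.L) → Fin m → ℝ) × (Fin (n + O.L) → Fin p → ℝ)) :=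
    {e | e ∈ LinearMap.range Φ ∧
    (∀ (k : Fin n) (j : Fin m), e.1 (Fin.castAdd O.L k) j = ξ (Sum.inl (k, j))) ∧
    (∀ (k : Fin n) (j : Fin p), e.2 (Fin.castAdd O.L k) j = ξ (Sum.inr (k, j))) ∧
    (∀ k : Fin O.L, e.1 (Fin.natAdd n k) ∈ O.U) ∧ (∀ k : Fin O.L, e.2 (Fin.natAdd n k) ∈ O.Y) ∧
    ∀ k : Fin O.L, O.L ≤ (k : ℕ) + n → e.1 (Fin.natAdd n k) = 0 ∧ e.2 (Fin.natAdd n k) = 0}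
  have hZ : IsClosed Z := by
    have hrange : IsClosed {e | e ∈ LinearMap.range Φ} :=
      (LinearMap.range Φ).closed_of_finiteDimensional
    refine hrange.and (IsClosed.and ?_ (IsClosed.and ?_
      (IsClosed.and ?_ (IsClosed.and ?_ ?_))))
    · simp only [Set.ofPred_forall]
      exact isClosed_iInter fun k => isClosed_iInter fun j =>
        isClosed_eq (by fun_prop) continuous_const
    · simp only [Set.ofPred_forall]
      exact isClosed_iInter fun k => isClosed_iInter fun j =>
        isClosed_eq (by fun_prop) continuous_const
    · simp only [Set.ofPred_forall]
      exact isClosed_iInter fun k => hU.preimage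
        (f := fun e : (Fin (n + O.L) → Fin m → ℝ) × (Fin (n + O.L) → Fin p → ℝ) =>
          e.1 (Fin.natAdd n k))
        (by fun_prop)
    · simp only [Set.ofPred_forall]
      exact isClosed_iInter fun k => hY.preimage
        (f := fun e : (Fin (n + O.L) → Fin m → ℝ) × (Fin (n + O.L) → Fin p → ℝ) =>
          e.2 (Fin.natAdd n k))
        (by fun_prop)
    · simp only [Set.ofPred_forall]
      exact isClosed_iInter fun k => isClosed_iInter fun _ =>
        (isClosed_eq (by fun_prop) continuous_const).and
          (isClosed_eq (by fun_prop) continuous_const)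
  have hmemZ : ∀ s : O.Var n, O.IsFeasiblePoint ξ s → (s.ubar, s.ybar) ∈ Z := fun s hs =>
    ⟨⟨s.alpha, Prod.ext (funext fun k => funext fun j => (hs.hankel_u k j).symm)
      (funext fun k => funext fun j => (hs.hankel_y k j).symm)⟩,
      hs.init_u, hs.init_y, hs.mem_U, hs.mem_Y, hs.terminal⟩
  let c₀ := O.cost s₀
  have hbd : Bornology.IsBounded (Z ∩ {e | J e ≤ c₀}) := by
    rw [isBounded_iff_forall_norm_le]
    refine ⟨‖(s₀.ubar, s₀.ybar)‖ + (√(c₀ / r) + √(c₀ / q)), fun e he => ?_⟩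
    have hn := norm_nonneg (s₀.ubar, s₀.ybar)
    have hn1 : ∀ k, ‖s₀.ubar k‖ ≤ ‖(s₀.ubar, s₀.ybar)‖ := fun k =>
      (norm_le_pi_norm s₀.ubar k).trans (norm_fst_le (s₀.ubar, s₀.ybar))
    have hn2 : ∀ k, ‖s₀.ybar k‖ ≤ ‖(s₀.ubar, s₀.ybar)‖ := fun k =>
      (norm_le_pi_norm s₀.ybar k).trans (norm_snd_le (s₀.ubar, s₀.ybar))
    have hk1 := Real.sqrt_nonneg (c₀ / r)
    have hk2 := Real.sqrt_nonneg (c₀ / q)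
    have hst : ∀ k : Fin O.L,
        wsq O.R (e.1 (Fin.natAdd n k)) + wsq O.Q (e.2 (Fin.natAdd n k)) ≤ c₀ := fun k =>
      (Finset.single_le_sum (f := fun k : Fin O.L =>
        wsq O.R (e.1 (Fin.natAdd n k)) + wsq O.Q (e.2 (Fin.natAdd n k)))
        (fun i _ => add_nonneg (wsq_nonneg hR _) (wsq_nonneg hQ _)) (Finset.mem_univ k)).trans he.2
    have key : ∀ {ι : Type} [Fintype ι] (v : ι → ℝ) (a : ℝ), 0 < a → a * norm2 v ^ 2 ≤ c₀ →
        ‖v‖ ≤ √(c₀ / a) := by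
      intro ι _ v a ha hv
      refine (norm_le_norm2 v).trans (Real.le_sqrt_of_sq_le ?_)
      rw [le_div_iff₀ ha]
      linarith
    rw [Prod.norm_def, max_le_iff]
    constructor
    · refine (pi_norm_le_iff_of_nonneg (by positivity)).2 fun k => ?_
      refine Fin.addCases (fun k => ?_) (fun k => ?_) k
      · have : e.1 (Fin.castAdd O.L k) = s₀.ubar (Fin.castAdd O.L k) := by
          ext j
          rw [he.1.2.1, hs₀.init_u]
        rw [this]
        linarith [hn1 (Fin.castAdd O.L k)]
      · have := key (e.1 (Fin.natAdd n k)) r hr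
          ((hrR _).trans (by linarith [hst k, wsq_nonneg hQ (e.2 (Fin.natAdd n k))]))
        linarith
    · refine (pi_norm_le_iff_of_nonneg (by positivity)).2 fun k => ?_
      refine Fin.addCases (fun k => ?_) (fun k => ?_) k
      · have : e.2 (Fin.castAdd O.L k) = s₀.ybar (Fin.castAdd O.L k) := by
          ext j
          rw [he.1.2.2.1, hs₀.init_y]
        rw [this]
        linarith [hn2 (Fin.castAdd O.L k)]
      · have := key (e.2 (Fin.natAdd n k)) q hq
          ((hqQ _).trans (by linarith [hst k, wsq_nonneg hR (e.1 (Fin.natAdd n k))]))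
        linarith
  have hcomp := Metric.isCompact_of_isClosed_isBounded
    (hZ.inter (isClosed_le hJ continuous_const)) hbd
  obtain ⟨e, he, hmin⟩ := hcomp.exists_isMinOn ⟨(s₀.ubar, s₀.ybar), hmemZ s₀ hs₀, le_refl c₀⟩
    hJ.continuousOn
  obtain ⟨⟨α, hα⟩, h1, h2, h3, h4, h5⟩ := he.1
  refine ⟨⟨α, e.1, e.2⟩, ⟨fun k j => ?_, fun k j => ?_, h1, h2, h3, h4, h5⟩, fun s hs => ?_⟩
  · rw [← hα]
    rfl
  · rw [← hα]
    rfl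
  · rcases le_total (O.cost s) c₀ with hc | hc
    · exact hmin ⟨hmemZ s hs, hc⟩
    · exact (show J e ≤ c₀ from he.2).trans hc

theorem IsOptimal.optCost_eq {s : O.Var n} (h : O.IsOptimal ξ s) :
    O.optCost ξ = ENNReal.ofReal (O.cost s) :=
  le_antisymm (iInf₂_le s h.1) (le_iInf₂ fun s' hs' => ENNReal.ofReal_le_ofReal (h.2 s' hs'))

theorem feasible_of_optCost_lt_top (h : O.optCost ξ < ⊤) : O.Feasible ξ := by
  by_contra hne
  refine h.ne ?_
  simp only [optCost, iInf_eq_top]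
  exact fun s hs => (hne ⟨s, hs⟩).elim

end OCP

/-! ### The shifted candidate and one closed-loop step. -/

namespace OCP

variable {n m p : ℕ} {O : OCP m p} {S : LTI n m p} {ξ : ExtIdx n m p → ℝ}

theorem stage_add_le (hR : O.R.PosDef) (hQ : O.Q.PosDef) {ε : ℝ} (hε : 0 < ε)
    (a a' : Fin m → ℝ) (b b' : Fin p → ℝ) :
    O.stage (a + a') (b + b') ≤ (1 + ε) * O.stage a b + (1 + 1 / ε) * O.stage a' b' := by
  have h1 := wsq_add_le hR hε a a'
  have h2 := wsq_add_le hQ hε b b'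
  simp only [stage, mul_add] at *
  linarith

theorem exists_stage_le (O : OCP m p) :
    ∃ c : ℝ, 0 ≤ c ∧ ∀ (a : Fin m → ℝ) (b : Fin p → ℝ) (M : ℝ), ‖a‖ ≤ M → ‖b‖ ≤ M →
      O.stage a b ≤ c * M ^ 2 := by
  obtain ⟨c₁, h₁, h₁'⟩ := exists_wsq_le_norm O.R
  obtain ⟨c₂, h₂, h₂'⟩ := exists_wsq_le_norm O.Q
  refine ⟨c₁ + c₂, by positivity, fun a b M ha hb => ?_⟩
  have e₁ : wsq O.R a ≤ c₁ * M ^ 2 := (h₁' a).trans (by gcongr)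
  have e₂ : wsq O.Q b ≤ c₂ * M ^ 2 := (h₂' b).trans (by gcongr)
  rw [stage, add_mul]
  exact add_le_add e₁ e₂

theorem sum_stage_add_le (hR : O.R.PosDef) (hQ : O.Q.PosDef) {ε c M : ℝ} (hε : 0 < ε)
    (hc : ∀ (a : Fin m → ℝ) (b : Fin p → ℝ) (M : ℝ), ‖a‖ ≤ M → ‖b‖ ≤ M → O.stage a b ≤ c * M ^ 2)
    (T : ℕ) {a w : ℕ → Fin m → ℝ} {b z : ℕ → Fin p → ℝ} (hw : ∀ k, ‖w k‖ ≤ M ∧ ‖z k‖ ≤ M) :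
    ∑ k ∈ Finset.range T, O.stage (a k + w k) (b k + z k) ≤
      (1 + ε) * ∑ k ∈ Finset.range T, O.stage (a k) (b k) + T * ((1 + 1 / ε) * (c * M ^ 2)) := by
  calc ∑ k ∈ Finset.range T, O.stage (a k + w k) (b k + z k)
      ≤ ∑ k ∈ Finset.range T, ((1 + ε) * O.stage (a k) (b k) + (1 + 1 / ε) * (c * M ^ 2)) := by
        refine Finset.sum_le_sum fun k _ => (stage_add_le hR hQ hε _ _ _ _).trans ?_
        have := hc _ _ _ (hw k).1 (hw k).2
        gcongr
    _ = _ := by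
        rw [Finset.sum_add_distrib, Finset.mul_sum, Finset.sum_const, Finset.card_range,
          nsmul_eq_mul]

/-- The previous plan, shifted by `n` steps and corrected for the disturbance, is a plan for the
measured extended state `ξ'`. -/
theorem IsPlan.shift {xb : ℕ → Fin n → ℝ} {ub : ℕ → Fin m → ℝ} {yb : ℕ → Fin p → ℝ}
    (h : O.IsPlan S ξ xb ub yb) (hobs : S.Observable) (hL : 2 * n ≤ O.L)
    {x : ℕ → Fin n → ℝ} {u : ℕ → Fin m → ℝ} {y : ℕ → Fin p → ℝ}
    (hrun : ∀ k, x (k + 1) = S.A *ᵥ x k + S.B *ᵥ u k ∧ y k = S.C *ᵥ x k + S.D *ᵥ u k)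
    (hpast : ∀ k < n, u k = ub k ∧ y k = yb k)
    {e : ℕ → Fin n → ℝ} {w : ℕ → Fin m → ℝ} (he0 : e 0 = 0)
    (he : ∀ k, e (k + 1) = S.A *ᵥ e k + S.B *ᵥ w k)
    (hw : ∀ k < n, u (n + k) = ub (n + k) + w k)
    (hw0 : ∀ k, n ≤ k → k < O.L - n → w k = 0) (hwL : ∀ k, O.L ≤ k → e k = 0 ∧ w k = 0)
    (hwU : ∀ k, w k ∈ O.U) {ξ' : ExtIdx n m p → ℝ}
    (hu : ∀ (k : Fin n) (j : Fin m), ξ' (Sum.inl (k, j)) = u (n + k) j)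
    (hy : ∀ (k : Fin n) (j : Fin p), ξ' (Sum.inr (k, j)) = y (n + k) j) :
    O.IsPlan S ξ' (fun k => xb (n + k) + e k) (fun k => ub (n + k) + w k)
      (fun k => yb (n + k) + (S.C *ᵥ e k + S.D *ᵥ w k)) ∧
    ∀ k < n, y (n + k) = yb (n + k) + (S.C *ᵥ e k + S.D *ᵥ w k) := by
  -- The matching past window fixes the state by observability, so plan and closed loop agree at the
  -- current time.
  have hxn : x n = xb n := by
    refine hobs.state_eq (u := ub) (y := yb) (fun k hk => ?_) (fun k _ => h.step k) n le_rfl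
    have := hrun k
    rwa [(hpast k hk).1, (hpast k hk).2] at this
  have hx : ∀ k ≤ n, x (n + k) = xb (n + k) + e k := by
    intro k
    induction k with
    | zero => simp [hxn, he0]
    | succ k ih =>
      intro hk
      rw [← Nat.add_assoc, (hrun _).1, (h.step _).1, ih (by omega), hw k (by omega), he,
        Matrix.mulVec_add, Matrix.mulVec_add]
      abel
  have hyk : ∀ k < n, y (n + k) = yb (n + k) + (S.C *ᵥ e k + S.D *ᵥ w k) := by
    intro k hk
    rw [(hrun _).2, (h.step _).2, hx k hk.le, hw k hk, Matrix.mulVec_add, Matrix.mulVec_add]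
    abel
  refine ⟨⟨fun k => ⟨?_, ?_⟩, fun k j => ?_, fun k j => ?_, fun k hk => ?_, fun k hk => ?_⟩, hyk⟩
  · simp only [← Nat.add_assoc, (h.step (n + k)).1, he, Matrix.mulVec_add]
    abel
  · simp only [(h.step (n + k)).2, Matrix.mulVec_add]
    abel
  · rw [hu, hw k k.2]
  · rw [hy, hyk k k.2]
  · simp [h.zero (n + k) (by omega), hwL k hk]
  -- Before `L - n` the input is the old planned one; from then on the old plan is zero and the
  -- input is the small correction. The disturbed first `n` entries form the initial window and
  -- carry no constraint.
  · by_cases hk' : k < O.L - n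
    · simpa [hw0 k hk hk'] using h.mem_U (n + k) (by omega)
    · simpa [h.zero (n + k) (by omega)] using hwU k

/-- One step of the closed loop: an optimal solution at time `n i`, and a feasible point at time
`n (i + 1)` obtained from it by shifting and a correction of the size of the disturbance. -/
theorem exists_closedLoop_step (hctrl : S.Controllable) (hobs : S.Observable)
    (hdata : S.IsIOTrajectory O.N O.ud O.yd) (hR : O.R.PosDef) (hQ : O.Q.PosDef)
    (hpe : PersistentlyExciting O.N (O.L + 2 * n) O.ud) (hU : IsClosed O.U)
    (hY : O.Y = Set.univ) (hU0 : (0 : Fin m → ℝ) ∈ interior O.U) (hL : 2 * n ≤ O.L) :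
    ∃ dbar K : ℝ, 0 < dbar ∧ 0 < K ∧
      ∀ (d : ℕ → Fin m → ℝ) (x : ℤ → Fin n → ℝ) (u : ℤ → Fin m → ℝ) (y : ℤ → Fin p → ℝ),
        O.IsClosedLoop S d x u y → ∀ M ≤ dbar, (∀ t, norm2 (d t) ≤ M) →
        ∀ i : ℕ, O.Feasible (extState n u y ((n * i : ℕ) : ℤ)) →
        ∃ (s s' : O.Var n) (ub w : ℕ → Fin m → ℝ) (yb z : ℕ → Fin p → ℝ),
          O.IsOptimal (extState n u y ((n * i : ℕ) : ℤ)) s ∧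
          O.IsFeasiblePoint (extState n u y ((n * i + n : ℕ) : ℤ)) s' ∧
          (∀ k, ‖w k‖ ≤ K * M ∧ ‖z k‖ ≤ K * M) ∧
          (∀ k, O.L ≤ k → ub k = 0 ∧ yb k = 0) ∧
          O.cost s = ∑ k ∈ Finset.range O.L, O.stage (ub k) (yb k) ∧
          O.cost s' = ∑ k ∈ Finset.range O.L,
            O.stage (ub (n + k) + w (n + k)) (yb (n + k) + z (n + k)) ∧
          ∀ k < n, u ((n * i : ℕ) + k) = ub k + w k ∧ y ((n * i : ℕ) + k) = yb k + z k := by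
  obtain ⟨K, hK, hcorr⟩ := hctrl.exists_correction hL
  obtain ⟨r, hr, hrU⟩ := Metric.mem_nhds_iff.1 (mem_interior_iff_mem_nhds.1 hU0)
  -- With this bound the correction is at most `r / 2`, hence inside the ball of radius `r` in `𝕌`.
  refine ⟨r / (2 * K), K, by positivity, hK, fun d x u y hcl M hM hd i hfeas => ?_⟩
  obtain ⟨hrun, hmpc⟩ := hcl
  have hYc : IsClosed O.Y := hY ▸ isClosed_univ
  obtain ⟨s, hs, hus⟩ := hmpc i (hfeas.exists_isOptimal hR hQ hU hYc)
  obtain ⟨xb, ub, yb, hplan, hcost, hub⟩ :=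
    hs.1.exists_isPlan hobs hdata (interior_subset hU0) (by omega)
  obtain ⟨e, w, he0, he, hwd, hw0, hwL, hwM⟩ := hcorr (fun k => d (n * i + k)) M
    fun k => (norm_le_norm2 _).trans (hd _)
  set t : ℤ := ((n * i : ℕ) : ℤ) with ht
  have ht0 : 0 ≤ t := Int.natCast_nonneg _
  have hshift : ∀ k : ℕ, t - n + ((n + k : ℕ) : ℤ) = t + k := fun k => by
    push_cast
    ring
  have hw : ∀ k < n, u (t + k) = ub (n + k) + w k := by
    intro k hk
    have h1 := hus ⟨k, by omega⟩ hk
    rw [← hub, ← hwd k hk] at h1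
    rw [← h1]
    congr 1
  obtain ⟨hplan', hy⟩ := hplan.shift hobs hL (x := fun k => x (t - n + k))
    (u := fun k => u (t - n + k)) (y := fun k => y (t - n + k))
    (fun k => by
      have := hrun (t - n + k) (by omega)
      rwa [add_assoc] at this)
    (fun k hk => ⟨funext fun j => (hplan.init_u ⟨k, hk⟩ j).symm,
      funext fun j => (hplan.init_y ⟨k, hk⟩ j).symm⟩)
    he0 he (fun k hk => by rw [hshift, hw k hk]) hw0 hwL
    (fun k => hrU (by
      rw [mem_ball_zero_iff]
      calc ‖w k‖ ≤ K * M := (hwM k).1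
        _ ≤ K * (r / (2 * K)) := by gcongr
        _ < r := by
          field_simp
          linarith))
    (ξ' := extState n u y ((n * i + n : ℕ) : ℤ))
    (fun k j => by
      rw [hshift]
      simp [extState, ht])
    (fun k j => by
      rw [hshift]
      simp [extState, ht])
  obtain ⟨s', hs', hcost'⟩ := hplan'.exists_isFeasiblePoint hctrl hdata hpe hY
  refine ⟨s, s', fun k => ub (n + k), w, fun k => yb (n + k),
    fun k => S.C *ᵥ e k + S.D *ᵥ w k, hs, hs', hwM, fun k hk => (hplan.zero _ (by omega)).2,
    hcost, hcost', fun k hk => ⟨hw k hk, ?_⟩⟩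
  rw [← hy k hk, hshift]

/-! ### IOSS Lyapunov functions. -/

/-- The decrease of an IOSS Lyapunov function over `j` steps. -/
theorem IsIOSS.wsq_le {P : Matrix (ExtIdx n m p) (ExtIdx n m p) ℝ} {c : ℝ}
    (h : O.IsIOSS S P c) {x : ℤ → Fin n → ℝ} {u : ℤ → Fin m → ℝ} {y : ℤ → Fin p → ℝ}
    (hrun : S.IsRun x u y) (t j : ℕ) :
    wsq P (extState n u y ((t + j : ℕ) : ℤ)) ≤ wsq P (extState n u y t) -
      ∑ k ∈ Finset.range j, norm2 (extState n u y ((t + k : ℕ) : ℤ)) ^ 2 +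
      c * ∑ k ∈ Finset.range j, O.stage (u (t + k)) (y (t + k)) := by
  induction j with
  | zero => simp
  | succ j ih =>
    have h1 := h.2.2 x u y hrun (t + j)
    rw [show ((t + j : ℕ) : ℤ) + 1 = ((t + (j + 1) : ℕ) : ℤ) by push_cast; ring] at h1
    rw [Finset.sum_range_succ, Finset.sum_range_succ, mul_add,
      show (t : ℤ) + (j : ℤ) = ((t + j : ℕ) : ℤ) by push_cast; rfl]
    change _ ≤ _ + (_ + c * (wsq O.R _ + wsq O.Q _))
    linarith

theorem IsIOSS.wsq_add_le {P : Matrix (ExtIdx n m p) (ExtIdx n m p) ℝ} {c : ℝ}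
    (h : O.IsIOSS S P c) {x : ℤ → Fin n → ℝ} {u : ℤ → Fin m → ℝ} {y : ℤ → Fin p → ℝ}
    (hrun : S.IsRun x u y) (t : ℕ) :
    wsq P (extState n u y ((t + n : ℕ) : ℤ)) ≤ wsq P (extState n u y t) -
      norm2 (extState n u y t) ^ 2 +
      c * ∑ k ∈ Finset.range n, O.stage (u (t + k)) (y (t + k)) := by
  refine (h.wsq_le hrun t n).trans ?_
  have : norm2 (extState n u y t) ^ 2 ≤
      ∑ k ∈ Finset.range n, norm2 (extState n u y ((t + k : ℕ) : ℤ)) ^ 2 := by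
    -- Only the first summand is kept; for `n = 0` the extended state is empty and has norm zero.
    rcases Nat.eq_zero_or_pos n with rfl | hn
    · simp [norm2_sq]
    · have h0 := Finset.single_le_sum
        (f := fun k => norm2 (extState n u y ((t + k : ℕ) : ℤ)) ^ 2)
        (fun k _ => sq_nonneg _) (Finset.mem_range.2 hn)
      simpa only [Nat.add_zero] using h0
  linarith

/-- Weighting the entries of the extended state by their position gives an IOSS Lyapunov
function. -/
theorem exists_isIOSS (S : LTI n m p) (hR : O.R.PosDef) (hQ : O.Q.PosDef) :
    ∃ (P : Matrix (ExtIdx n m p) (ExtIdx n m p) ℝ) (c : ℝ), O.IsIOSS S P c := by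
  obtain ⟨r, hr, hrR⟩ := exists_norm2_le_wsq hR
  obtain ⟨q, hq, hqQ⟩ := exists_norm2_le_wsq hQ
  set D : ExtIdx n m p → ℝ :=
    Sum.elim (fun kj => ((kj.1 : ℕ) : ℝ) + 1) (fun kj => ((kj.1 : ℕ) : ℝ) + 1) with hD
  have hW : ∀ (u : ℤ → Fin m → ℝ) (y : ℤ → Fin p → ℝ) (t : ℤ),
      wsq (Matrix.diagonal D) (extState n u y t) = ∑ k ∈ Finset.range n, ((k : ℝ) + 1) *
        (norm2 (u (t - n + k)) ^ 2 + norm2 (y (t - n + k)) ^ 2) := by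
    intro u y t
    rw [wsq, dotProduct, Finset.sum_range]
    simp only [Matrix.mulVec_diagonal, Fintype.sum_sum_type, Fintype.sum_prod_type, hD, extState,
      Sum.elim_inl, Sum.elim_inr, ← Finset.sum_add_distrib, norm2_sq, mul_add, Finset.mul_sum]
    refine Finset.sum_congr rfl fun k _ => ?_
    congr 1 <;> exact Finset.sum_congr rfl fun j _ => by ring
  have hN : ∀ (u : ℤ → Fin m → ℝ) (y : ℤ → Fin p → ℝ) (t : ℤ),
      norm2 (extState n u y t) ^ 2 = ∑ k ∈ Finset.range n,
        (norm2 (u (t - n + k)) ^ 2 + norm2 (y (t - n + k)) ^ 2) := by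
    intro u y t
    rw [norm2_sq, Finset.sum_range]
    simp only [Fintype.sum_sum_type, Fintype.sum_prod_type, extState,
      Sum.elim_inl, Sum.elim_inr, ← Finset.sum_add_distrib, norm2_sq]
  -- The weights grow from `1` (oldest) to `n` (newest). One time step lowers every stored weight by
  -- one and adds the new pair with weight `n`; the factor `n + 1` keeps the constant positive when
  -- `n = 0`.
  refine ⟨Matrix.diagonal D, (n + 1) * (1 / r + 1 / q),
    Matrix.PosDef.diagonal fun i => ?_, by positivity, fun x u y _ t => ?_⟩
  · rcases i with i | i <;> simp only [hD, Sum.elim_inl, Sum.elim_inr] <;> positivity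
  · rw [hW, hW, hN]
    set f : ℕ → ℝ := fun k => norm2 (u ((t : ℤ) - n + k)) ^ 2 + norm2 (y ((t : ℤ) - n + k)) ^ 2
      with hf
    have e1 : ∀ k : ℕ, norm2 (u ((t : ℤ) + 1 - n + k)) ^ 2 + norm2 (y ((t : ℤ) + 1 - n + k)) ^ 2
        = f (k + 1) := by
      intro k
      have : (t : ℤ) + 1 - n + k = (t : ℤ) - n + (k + 1 : ℕ) := by
        push_cast
        ring
      rw [hf, this]
    have e2 : f n = norm2 (u t) ^ 2 + norm2 (y t) ^ 2 := by
      simp [hf]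
    simp only [e1]
    have e3 : ∑ k ∈ Finset.range n, ((k : ℝ) + 1) * f (k + 1) =
        ∑ k ∈ Finset.range n, (k : ℝ) * f k + n * f n := by
      rw [← Finset.sum_range_succ (fun k : ℕ => (k : ℝ) * f k),
        Finset.sum_range_succ' (fun k : ℕ => (k : ℝ) * f k)]
      simp
    have e4 : ∑ k ∈ Finset.range n, ((k : ℝ) + 1) * f k =
        ∑ k ∈ Finset.range n, (k : ℝ) * f k + ∑ k ∈ Finset.range n, f k := by
      rw [← Finset.sum_add_distrib]
      exact Finset.sum_congr rfl fun k _ => by ring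
    have hu : norm2 (u t) ^ 2 ≤ 1 / r * wsq O.R (u t) := by
      rw [one_div, ← div_eq_inv_mul, le_div_iff₀ hr, mul_comm]
      exact hrR _
    have hy : norm2 (y t) ^ 2 ≤ 1 / q * wsq O.Q (y t) := by
      rw [one_div, ← div_eq_inv_mul, le_div_iff₀ hq, mul_comm]
      exact hqQ _
    have hr' : 0 < 1 / r := by positivity
    have hq' : 0 < 1 / q := by positivity
    have h1 := wsq_nonneg hR (u t)
    have h2 := wsq_nonneg hQ (y t)
    have h3 : f n ≤ (1 / r + 1 / q) * (wsq O.R (u t) + wsq O.Q (y t)) := by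
      rw [e2]
      nlinarith [mul_nonneg hr'.le h2, mul_nonneg hq'.le h1]
    have h4 : (n : ℝ) * f n ≤
        (n + 1) * (1 / r + 1 / q) * (wsq O.R (u t) + wsq O.Q (y t)) := by
      rw [mul_assoc]
      have h5 : 0 ≤ f n := by rw [e2]; positivity
      have h6 : (n : ℝ) * f n ≤ (n + 1) * f n := by linarith
      exact h6.trans (by gcongr)
    rw [e3, e4]
    simp only [hf] at h4 ⊢
    linarith

end OCP

end DDMPC

/-! ### The gain function and the main theorem. -/

theorem DDMPC.isKInfty_mul_sq {c : ℝ≥0} (hc : 0 < c) : DDMPC.IsKInfty fun s => c * s ^ 2 where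
  continuous := by fun_prop
  strictMono := fun a b hab => by
    beta_reduce
    gcongr
  unbounded := fun r => by
    refine ⟨r / c + 1, ?_⟩
    calc r = c * (r / c) := (mul_div_cancel₀ r hc.ne').symm
      _ ≤ c * (r / c + 1) ^ 2 := by
        gcongr
        exact le_self_add.trans (le_self_pow₀ le_add_self two_ne_zero)
  map_zero := by simp

theorem mainTheorem2 {n m p : ℕ} (S : DDMPC.LTI n m p) (O : DDMPC.OCP m p)
    -- standing assumptions
    (hctrl : S.Controllable) (hobs : S.Observable)
    (hdata : S.IsIOTrajectory O.N O.ud O.yd)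
    (hR : O.R.PosDef) (hQ : O.Q.PosDef)
    -- persistence of excitation of order `L + 2 n`
    (hpe : DDMPC.PersistentlyExciting O.N (O.L + 2 * n) O.ud)
    -- quadratic upper bound on the optimal cost
    (hub : ∃ cu : ℝ, 0 < cu ∧ ∀ ξ : DDMPC.ExtIdx n m p → ℝ, O.Feasible ξ →
      O.optCost ξ ≤ ENNReal.ofReal (cu * DDMPC.norm2 ξ ^ 2))
    -- `𝕌` is a compact convex polytope and there are no output constraints
    (hU : ∃ F : Finset (Fin m → ℝ), O.U = convexHull ℝ (F : Set (Fin m → ℝ)))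
    (hY : O.Y = Set.univ)
    (hU0 : (0 : Fin m → ℝ) ∈ interior O.U) (hL : 2 * n ≤ O.L) :
    -- recursive feasibility
    (∃ dbar : ℝ, 0 < dbar ∧
      ∀ (d : ℕ → Fin m → ℝ) (x : ℤ → Fin n → ℝ) (u : ℤ → Fin m → ℝ) (y : ℤ → Fin p → ℝ),
        O.IsClosedLoop S d x u y → (∀ t, DDMPC.norm2 (d t) ≤ dbar) →
        O.Feasible (DDMPC.extState n u y 0) →
        ∀ i : ℕ, O.Feasible (DDMPC.extState n u y ((n * i : ℕ) : ℤ))) ∧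
    -- an IOSS Lyapunov function exists, and for each one `V` is a practical Lyapunov function
    (∃ (P : Matrix (DDMPC.ExtIdx n m p) (DDMPC.ExtIdx n m p) ℝ) (c : ℝ), O.IsIOSS S P c) ∧
    (∀ (P : Matrix (DDMPC.ExtIdx n m p) (DDMPC.ExtIdx n m p) ℝ) (c : ℝ), O.IsIOSS S P c →
      ∀ Vbar : ℝ, 0 < Vbar →
      ∃ (dmax cl cu cV : ℝ) (β : ℝ≥0 → ℝ≥0),
        0 < dmax ∧ 0 < cl ∧ 0 < cu ∧ 0 < cV ∧ cV < 1 ∧ DDMPC.IsKInfty β ∧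
        ∀ (dbar : ℝ≥0), (dbar : ℝ) ≤ dmax →
        ∀ (d : ℕ → Fin m → ℝ) (x : ℤ → Fin n → ℝ) (u : ℤ → Fin m → ℝ) (y : ℤ → Fin p → ℝ),
          O.IsClosedLoop S d x u y → (∀ t, DDMPC.norm2 (d t) ≤ dbar) →
          O.lyap P c (DDMPC.extState n u y 0) ≤ ENNReal.ofReal Vbar →
          ∀ i : ℕ,
            ENNReal.ofReal (cl * DDMPC.norm2 (DDMPC.extState n u y ((n * i : ℕ) : ℤ)) ^ 2) ≤
              O.lyap P c (DDMPC.extState n u y ((n * i : ℕ) : ℤ)) ∧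
            O.lyap P c (DDMPC.extState n u y ((n * i : ℕ) : ℤ)) ≤
              ENNReal.ofReal
                (cu * DDMPC.norm2 (DDMPC.extState n u y ((n * i : ℕ) : ℤ)) ^ 2) ∧
            O.lyap P c (DDMPC.extState n u y ((n * i + n : ℕ) : ℤ)) ≤
              ENNReal.ofReal cV * O.lyap P c (DDMPC.extState n u y ((n * i : ℕ) : ℤ)) +
                (β dbar : ℝ≥0∞)) := by

  have hUc : IsClosed O.U := by
    obtain ⟨F, hF⟩ := hU
    rw [hF]
    exact (F.finite_toSet.isCompact_convexHull ℝ).isClosed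
  have hYc : IsClosed O.Y := hY ▸ isClosed_univ
  obtain ⟨dbar, K, hdbar, hK, hstep⟩ :=
    DDMPC.OCP.exists_closedLoop_step hctrl hobs hdata hR hQ hpe hUc hY hU0 hL
  have hrec : ∀ (d : ℕ → Fin m → ℝ) (x : ℤ → Fin n → ℝ) (u : ℤ → Fin m → ℝ)
      (y : ℤ → Fin p → ℝ), O.IsClosedLoop S d x u y → (∀ t, DDMPC.norm2 (d t) ≤ dbar) →
      O.Feasible (DDMPC.extState n u y 0) →
      ∀ i : ℕ, O.Feasible (DDMPC.extState n u y ((n * i : ℕ) : ℤ)) := by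
    intro d x u y hcl hd h0 i
    induction i with
    | zero => simpa using h0
    | succ i ih =>
      obtain ⟨s, s', _, _, _, _, _, hs', _⟩ := hstep d x u y hcl dbar le_rfl hd i ih
      exact ⟨s', by rwa [Nat.mul_succ]⟩
  refine ⟨⟨dbar, hdbar, hrec⟩, DDMPC.OCP.exists_isIOSS S hR hQ, fun P c hP Vbar _ => ?_⟩
  obtain ⟨cu, hcu, hub⟩ := hub
  have hc : 0 < c := hP.2.1
  obtain ⟨lam, hlam, hlamP⟩ := DDMPC.exists_norm2_le_wsq hP.1
  obtain ⟨Lam, hLam, hLamP⟩ := DDMPC.exists_wsq_le_norm2 P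
  obtain ⟨g, hg, hgs⟩ := O.exists_stage_le
  -- Chosen so that `ε * cu = 1 / (2 * c)`, half of the IOSS decrease rate `1 / c`.
  set ε : ℝ := 1 / (2 * c * cu) with hε
  have hε0 : 0 < ε := by positivity
  -- The `+ 1` makes the denominator exceed `1`, hence `0 < cV`; the `+ 1` in `b` keeps the gain
  -- strictly increasing.
  set cV : ℝ := 1 - 1 / (2 * (c * cu + Lam + 1)) with hcV
  set b : ℝ := (1 + 1 / ε) * g * K ^ 2 * (O.L + n) + 1 with hb
  have hb0 : 0 < b := by positivity
  have hden : 1 < 2 * (c * cu + Lam + 1) := by nlinarith [mul_pos hc hcu]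
  have hinv : 1 / (2 * (c * cu + Lam + 1)) < 1 := by
    rw [div_lt_one (by linarith)]
    exact hden
  have hinv0 : 0 < 1 / (2 * (c * cu + Lam + 1)) := by positivity
  refine ⟨dbar, lam / c, cu + Lam / c, cV, fun s => b.toNNReal * s ^ 2, hdbar, by positivity,
    by positivity, by linarith, by linarith, DDMPC.isKInfty_mul_sq (Real.toNNReal_pos.2 hb0),
    fun M hM d x u y hcl hd hV i => ?_⟩
  -- A finite value of `V` at time zero means that the problem is feasible there.
  have hfeas := hrec d x u y hcl (fun t => (hd t).trans hM)
    (DDMPC.OCP.feasible_of_optCost_lt_top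
      (lt_of_le_of_lt (le_self_add.trans hV) ENNReal.ofReal_lt_top)) i
  obtain ⟨s, s', a, w, e, z, hs, hs', hwz, hzero, hJ, hJ', huy⟩ :=
    hstep d x u y hcl M hM hd i hfeas
  set ξ := DDMPC.extState n u y ((n * i : ℕ) : ℤ) with hξ
  set ξ' := DDMPC.extState n u y ((n * i + n : ℕ) : ℤ) with hξ'
  have hst := DDMPC.OCP.stage_nonneg (O := O) hR hQ
  have hW0 := DDMPC.wsq_nonneg hP.1 ξ
  have hJ0 : 0 ≤ O.cost s := hJ ▸ Finset.sum_nonneg fun k _ => hst _ _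
  have hJ0' : 0 ≤ O.cost s' := hJ' ▸ Finset.sum_nonneg fun k _ => hst _ _
  have hWc : 0 ≤ 1 / c * DDMPC.wsq P ξ := by positivity
  have hWc' : 0 ≤ 1 / c * DDMPC.wsq P ξ' :=
    mul_nonneg (by positivity) (DDMPC.wsq_nonneg hP.1 ξ')
  have hJub : O.cost s ≤ cu * DDMPC.norm2 ξ ^ 2 := by
    have := hub ξ hfeas
    rwa [hs.optCost_eq, ENNReal.ofReal_le_ofReal_iff (by positivity)] at this
  have hVeq : O.lyap P c ξ = ENNReal.ofReal (O.cost s + 1 / c * DDMPC.wsq P ξ) := by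
    rw [DDMPC.OCP.lyap, hs.optCost_eq, ENNReal.ofReal_add hJ0 hWc]
  have hWu : 1 / c * DDMPC.wsq P ξ ≤ Lam / c * DDMPC.norm2 ξ ^ 2 := by
    calc 1 / c * DDMPC.wsq P ξ ≤ 1 / c * (Lam * DDMPC.norm2 ξ ^ 2) := by
          gcongr
          exact hLamP ξ
      _ = Lam / c * DDMPC.norm2 ξ ^ 2 := by ring
  have hWl : lam / c * DDMPC.norm2 ξ ^ 2 ≤ 1 / c * DDMPC.wsq P ξ := by
    calc lam / c * DDMPC.norm2 ξ ^ 2 = 1 / c * (lam * DDMPC.norm2 ξ ^ 2) := by ring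
      _ ≤ _ := by
          gcongr
          exact hlamP ξ
  have hVu : O.cost s + 1 / c * DDMPC.wsq P ξ ≤ (cu + Lam / c) * DDMPC.norm2 ξ ^ 2 := by
    rw [add_mul]
    exact add_le_add hJub hWu
  refine ⟨?_, ?_, ?_⟩
  · rw [hVeq]
    exact ENNReal.ofReal_le_ofReal (by linarith)
  · rw [hVeq]
    exact ENNReal.ofReal_le_ofReal hVu
  · set N₁ := ∑ k ∈ Finset.range n, O.stage (a k) (e k) with hN₁
    set E := (1 + 1 / ε) * (g * (K * M) ^ 2) with hE
    -- The shift drops the first `n` stages and appends `n` stages that are zero.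
    have hshift : ∑ k ∈ Finset.range O.L, O.stage (a (n + k)) (e (n + k)) = O.cost s - N₁ := by
      have h1 := Finset.sum_range_add (fun k => O.stage (a k) (e k)) n O.L
      have h2 := Finset.sum_range_add (fun k => O.stage (a k) (e k)) O.L n
      rw [add_comm O.L n, Finset.sum_eq_zero (s := Finset.range n)
        (f := fun k => O.stage (a (O.L + k)) (e (O.L + k))) (fun k _ => by
          rw [(hzero (O.L + k) (by omega)).1, (hzero (O.L + k) (by omega)).2,
            DDMPC.OCP.stage_zero])] at h2
      rw [hJ]
      linarith
    have hcand : O.cost s' ≤ (1 + ε) * (O.cost s - N₁) + O.L * E := by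
      rw [hJ', ← hshift]
      exact DDMPC.OCP.sum_stage_add_le hR hQ hε0 hgs O.L fun k => hwz (n + k)
    have hioss := hP.wsq_add_le hcl.1 (n * i)
    have hreal : ∑ k ∈ Finset.range n,
        O.stage (u ((n * i : ℕ) + k)) (y ((n * i : ℕ) + k)) ≤ (1 + ε) * N₁ + n * E := by
      refine le_trans (le_of_eq (Finset.sum_congr rfl fun k hk => ?_))
        (DDMPC.OCP.sum_stage_add_le hR hQ hε0 hgs n hwz)
      rw [(huy k (Finset.mem_range.1 hk)).1, (huy k (Finset.mem_range.1 hk)).2]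
    rw [← hξ, ← hξ'] at hioss
    have hW' : 1 / c * DDMPC.wsq P ξ' ≤ 1 / c * DDMPC.wsq P ξ -
        1 / c * DDMPC.norm2 ξ ^ 2 + ((1 + ε) * N₁ + n * E) := by
      have h1 := hioss.trans (add_le_add_right (mul_le_mul_of_nonneg_left hreal hc.le) _)
      calc 1 / c * DDMPC.wsq P ξ' ≤ 1 / c * (DDMPC.wsq P ξ - DDMPC.norm2 ξ ^ 2 +
            c * ((1 + ε) * N₁ + n * E)) := by gcongr
        _ = _ := by
          field_simp
    have hεJ : ε * O.cost s ≤ 1 / (2 * c) * DDMPC.norm2 ξ ^ 2 := by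
      calc ε * O.cost s ≤ ε * (cu * DDMPC.norm2 ξ ^ 2) := by gcongr
        _ = _ := by
          rw [hε]
          field_simp
    have hdec : 1 / (2 * (c * cu + Lam + 1)) * (O.cost s + 1 / c * DDMPC.wsq P ξ) ≤
        1 / (2 * c) * DDMPC.norm2 ξ ^ 2 := by
      have hVu' : O.cost s + 1 / c * DDMPC.wsq P ξ ≤
          (c * cu + Lam + 1) / c * DDMPC.norm2 ξ ^ 2 := by
        refine hVu.trans (mul_le_mul_of_nonneg_right ?_ (sq_nonneg _))
        rw [le_div_iff₀ hc, add_mul, div_mul_cancel₀ _ hc.ne']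
        linarith
      calc 1 / (2 * (c * cu + Lam + 1)) * (O.cost s + 1 / c * DDMPC.wsq P ξ) ≤
          1 / (2 * (c * cu + Lam + 1)) * ((c * cu + Lam + 1) / c * DDMPC.norm2 ξ ^ 2) := by
            gcongr
        _ = _ := by
          field_simp
    have hbM : (O.L + n) * E ≤ b * (M : ℝ) ^ 2 := by
      have : b * (M : ℝ) ^ 2 = (O.L + n) * E + (M : ℝ) ^ 2 := by
        rw [hb, hE]
        ring
      rw [this]
      linarith [sq_nonneg (M : ℝ)]
    have hc2 : 1 / c = 2 * (1 / (2 * c)) := by field_simp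
    -- Adding `hcand` and `hW'` cancels `N₁`; `hεJ` uses up half of the decrease and `hdec` turns
    -- the other half into a contraction.
    have hfin : O.cost s' + 1 / c * DDMPC.wsq P ξ' ≤
        cV * (O.cost s + 1 / c * DDMPC.wsq P ξ) + b * (M : ℝ) ^ 2 := by
      have h2 : 1 / c * DDMPC.norm2 ξ ^ 2 = 2 * (1 / (2 * c) * DDMPC.norm2 ξ ^ 2) := by
        rw [hc2]
        ring
      have h3 : cV * (O.cost s + 1 / c * DDMPC.wsq P ξ) =
          O.cost s + 1 / c * DDMPC.wsq P ξ -
            1 / (2 * (c * cu + Lam + 1)) * (O.cost s + 1 / c * DDMPC.wsq P ξ) := by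
        rw [hcV]
        ring
      rw [h3]
      linarith
    have hcV0 : 0 ≤ cV := by linarith
    calc O.lyap P c ξ' ≤ ENNReal.ofReal (O.cost s') + ENNReal.ofReal (1 / c * DDMPC.wsq P ξ') :=
          add_le_add_left (iInf₂_le s' hs') _
      _ = ENNReal.ofReal (O.cost s' + 1 / c * DDMPC.wsq P ξ') :=
          (ENNReal.ofReal_add hJ0' hWc').symm
      _ ≤ ENNReal.ofReal (cV * (O.cost s + 1 / c * DDMPC.wsq P ξ) + b * (M : ℝ) ^ 2) :=
          ENNReal.ofReal_le_ofReal hfin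
      _ = ENNReal.ofReal cV * O.lyap P c ξ + ((b.toNNReal * M ^ 2 : ℝ≥0) : ℝ≥0∞) := by
          rw [ENNReal.ofReal_add (by positivity) (by positivity), ENNReal.ofReal_mul hcV0, hVeq,
            ENNReal.ofReal_mul hb0.le, ENNReal.ofReal_pow (NNReal.coe_nonneg M),
            ENNReal.ofReal_coe_nnreal]
          push_cast
          rfl
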